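/- Let $n\ge 1$. The interval poset $P(\pi)$ of a permutation $\pi\in\mathcal S_n$ is the set of its intervals, ordered by inclusion; an interval of $\pi$ is a non-empty set of consecutive integers $[a,b]\subseteq[n]$ that is the set of values of $\pi$ on a block of consecutive positions. Interval posets are counted as labelled objects: two are the same if they consist of the same sets $[a,b]$. Number the vertices of the convex $(n+1)$-gon $1,\dots,n+1$ in cyclic order (for $n=1$ the "$2$-gon" is a segment without diagonals). A dissection is a set of diagonals, which are allowed to cross; outer edges are not diagonals. A dissection is diagonally framed if, whenever two of its diagonals $\{a,b\}$ and $\{c,d\}$ cross, each of $\{a,c\},\{a,d\},\{b,c\},\{b,d\}$ is a diagonal of the dissection or an outer edge. It contains a quadrilateral if there are vertices $a<b<c<d$ such that each of $\{a,b\},\{b,c\},\{c,d\},\{a,d\}$ is a diagonal of the dissection or an outer edge, and neither $\{a,c\}$ nor $\{b,d\}$ belongs to the dissection. Then the number of interval posets of permutations in $\mathcal S_n$ equals the number of diagonally framed dissections of the convex $(n+1)$-gon that contain no quadrilateral. Moreover, the map $\Phi$ that sends an interval poset $P$ to the set of diagonals $\{a,b+1\}$, where $[a,b]$ runs over the elements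 of $P$ with $a<b$ and $[a,b]\ne[1,n]$, is a bijection between these two sets. -/

import Mathlib

namespace IntervalPosets

/-- `I` is an interval (block) of the permutation `π`, recorded by its set of values: `I` is a
non-empty contiguous set of values that is taken by `π` on a contiguous set of positions.
Positions and values are numbered `0, …, n - 1` instead of `1, …, n`. -/
def IsInterval {n : ℕ} (π : Equiv.Perm (Fin n)) (I : Set (Fin n)) : Prop :=
  (∃ a b : Fin n, a ≤ b ∧ I = Set.Icc a b) ∧
    ∃ i j : Fin n, i ≤ j ∧ I = π '' Set.Icc i j

/-- The interval poset `P(π)`: the set of all intervals of `π`. It is ordered by inclusion, the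
order that Mathlib puts on the elements of a set of sets, so that two interval posets are equal
if and only if they have the same elements. -/
def intervalPoset {n : ℕ} (π : Equiv.Perm (Fin n)) : Set (Set (Fin n)) :=
  {I | IsInterval π I}

/-- All interval posets of permutations in `S_n`, each counted once. -/
def intervalPosets (n : ℕ) : Set (Set (Set (Fin n))) :=
  Set.range (fun π : Equiv.Perm (Fin n) => intervalPoset π)

/-- The outer edges `{i, i + 1}` of the convex `(n + 1)`-gon, whose vertices are numbered
`0, …, n` in cyclic order; the addition is modulo `n + 1`, so `{0, n}` is an outer edge. -/
def IsOuterEdge {n : ℕ} (e : Sym2 (Fin (n + 1))) : Prop :=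
  ∃ i : Fin (n + 1), e = s(i, i + 1)

/-- A diagonal joins two distinct vertices and is not an outer edge. -/
def IsDiagonal {n : ℕ} (e : Sym2 (Fin (n + 1))) : Prop :=
  ¬ e.IsDiag ∧ ¬ IsOuterEdge e

/-- A dissection of the `(n + 1)`-gon is given by its set of diagonals, which may cross. -/
def IsDissection {n : ℕ} (D : Set (Sym2 (Fin (n + 1)))) : Prop :=
  ∀ e ∈ D, IsDiagonal e

/-- Two diagonals of a convex polygon cross (in their interiors) if and only if their endpoints
are four distinct vertices that alternate around the polygon. -/
def Crosses {n : ℕ} (e f : Sym2 (Fin (n + 1))) : Prop :=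
  ∃ p q r s : Fin (n + 1), p < q ∧ q < r ∧ r < s ∧
    ((e = s(p, r) ∧ f = s(q, s)) ∨ (e = s(q, s) ∧ f = s(p, r)))

/-- The vertices `x` and `y` are connected by a diagonal of `D` or by an outer edge. -/
def Connected {n : ℕ} (D : Set (Sym2 (Fin (n + 1)))) (x y : Fin (n + 1)) : Prop :=
  s(x, y) ∈ D ∨ IsOuterEdge s(x, y)

/-- Whenever two diagonals of `D` cross, each endpoint of one is connected to each endpoint of
the other. -/
def IsDiagonallyFramed {n : ℕ} (D : Set (Sym2 (Fin (n + 1)))) : Prop :=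
  ∀ a b c d : Fin (n + 1), s(a, b) ∈ D → s(c, d) ∈ D → Crosses s(a, b) s(c, d) →
    Connected D a d ∧ Connected D b d ∧ Connected D c b ∧ Connected D c a

/-- `D` contains an (unsubdivided) quadrilateral: four vertices in cyclic order whose four
consecutive pairs are connected, while neither of the two diagonals of the quadrilateral is
present. -/
def HasQuadrilateral {n : ℕ} (D : Set (Sym2 (Fin (n + 1)))) : Prop :=
  ∃ a b c d : Fin (n + 1), a < b ∧ b < c ∧ c < d ∧
    Connected D a b ∧ Connected D b c ∧ Connected D c d ∧ Connected D a d ∧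
    s(a, c) ∉ D ∧ s(b, d) ∉ D

/-- The diagonally framed dissections of the convex `(n + 1)`-gon without quadrilaterals. -/
def framedDissections (n : ℕ) : Set (Set (Sym2 (Fin (n + 1)))) :=
  {D | IsDissection D ∧ IsDiagonallyFramed D ∧ ¬ HasQuadrilateral D}

/-- The map `Φ`: each non-singleton interval `[a, b]` gives `{a, b + 1}`, a diagonal unless
`[a, b]` is the whole of `[n]`, in which case it is the outer edge `{0, n}` and is not recorded
in the set of diagonals. -/
def Phi {n : ℕ} (P : Set (Set (Fin n))) : Set (Sym2 (Fin (n + 1))) :=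
  {e | IsDiagonal e ∧ ∃ a b : Fin n, a < b ∧ Set.Icc a b ∈ P ∧ e = s(a.castSucc, b.succ)}

end IntervalPosets

/-! Write a permutation as an order on its values, given by an injective key: the position of each
value. A set of consecutive values is an interval exactly when it is convex for this order. The
vertex `v` of the polygon stands for the value `v`, so that the chord `{u, w}` stands for the
half-open segment `[u, w)`. Sides correspond to singletons and `{0, n}` to the set of all values,
which are always intervals; hence chords that are diagonals or outer edges match intervals exactly,
and `Phi` loses nothing.

Image: two overlapping convex sets, neither containing the other, have convex intersection, union
and differences, which is the framing condition. If three disjoint convex sets `A`, `B`, `C` have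
convex union, then `A ∪ B` or `B ∪ C` is convex, since `A` and `C` cannot both be the middle one;
this excludes quadrilaterals.

Surjectivity: induction on the vertex set, for an abstract relation with the same closure
properties. Take a shortest chord `{x, y}` with a vertex strictly between its ends, delete the
vertices in between, realize the smaller relation, and replace `x` by an ordered block. If at least
two vertices were deleted, then at least three were, since otherwise there would be an empty
quadrilateral; the block has at least four elements and carries a simple order
(`exists_simple_order`), and nothing crosses `{x, y}`. If one vertex `z` was deleted, the block is
the pair `x`, `z`, and only its orientation is free; framing makes the chords ending at `z` agree on
one orientation (`exists_side`). -/

namespace IntervalPosets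

/-! ### Convex sets of a linear order -/

/-- `S` is convex in `E` for the order of `E` by the key `f`. -/
def KeyConvex {ι : Type*} (f : ι → ℤ) (E S : Set ι) : Prop :=
  ∀ i ∈ S, ∀ j ∈ S, ∀ k ∈ E, f i < f k → f k < f j → k ∈ S

namespace KeyConvex

variable {ι : Type*} {f : ι → ℤ} {E S T A B C : Set ι}

theorem inter (hS : KeyConvex f E S) (hT : KeyConvex f E T) : KeyConvex f E (S ∩ T) :=
  fun i hi j hj k hk h1 h2 =>
    ⟨hS i hi.1 j hj.1 k hk h1 h2, hT i hi.2 j hj.2 k hk h1 h2⟩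

theorem union (hf : Set.InjOn f E) (hSE : S ⊆ E) (hS : KeyConvex f E S) (hT : KeyConvex f E T)
    (hne : (S ∩ T).Nonempty) : KeyConvex f E (S ∪ T) := by
  obtain ⟨p, hpS, hpT⟩ := hne
  intro i hi j hj k hk h1 h2
  rcases lt_trichotomy (f k) (f p) with h | h | h
  · rcases hi with hi | hi
    · exact Or.inl (hS i hi p hpS k hk h1 h)
    · exact Or.inr (hT i hi p hpT k hk h1 h)
  · exact Or.inl (hf hk (hSE hpS) h ▸ hpS)
  · rcases hj with hj | hj
    · exact Or.inl (hS p hpS j hj k hk h h2)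
    · exact Or.inr (hT p hpT j hj k hk h h2)

/-- A point `k` of `T` between two points of `S \ T` would force `T`, which also reaches a point `q`
outside `S`, to pass over one of these two points. -/
theorem diff (hf : Set.InjOn f E) (hSE : S ⊆ E) (hTE : T ⊆ E) (hS : KeyConvex f E S)
    (hT : KeyConvex f E T) (hne : (T \ S).Nonempty) : KeyConvex f E (S \ T) := by
  obtain ⟨q, hqT, hqS⟩ := hne
  intro i hi j hj k hk h1 h2
  refine ⟨hS i hi.1 j hj.1 k hk h1 h2, fun hkT => ?_⟩
  have hqi : f q ≠ f i := fun h => hqS (hf (hTE hqT) (hSE hi.1) h ▸ hi.1)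
  rcases lt_or_gt_of_ne hqi with h | h
  · exact hi.2 (hT q hqT k hkT i (hSE hi.1) h h1)
  · rcases lt_or_ge (f q) (f j) with h' | h'
    · exact hqS (hS i hi.1 j hj.1 q (hTE hqT) h h')
    · have hqj : f q ≠ f j := fun h => hqS (hf (hTE hqT) (hSE hj.1) h ▸ hj.1)
      exact hj.2 (hT k hkT q hqT j (hSE hj.1) h2 (lt_of_le_of_ne h' hqj.symm))

/-- If `A ∪ B` is not convex, a point of `C` separates `A` from `B`; if `B ∪ C` is not convex, a
point of `A` separates `B` from `C`. Both cannot happen. -/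
theorem union_or_union (hf : Set.InjOn f E) (hAE : A ⊆ E) (hBE : B ⊆ E) (hCE : C ⊆ E)
    (hA : KeyConvex f E A) (hB : KeyConvex f E B) (hC : KeyConvex f E C)
    (hBC : Disjoint B C) (hAC : Disjoint A C)
    (h : KeyConvex f E (A ∪ B ∪ C)) : KeyConvex f E (A ∪ B) ∨ KeyConvex f E (B ∪ C) := by
  rw [Set.disjoint_left] at hBC hAC
  have key : ∀ {X Y : Set ι}, X ⊆ E → Y ⊆ E → (∀ ⦃a⦄, a ∈ X → a ∉ Y) → ∀ x ∈ X, ∀ y ∈ Y,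
      f x < f y ∨ f y < f x := fun hX hY hd x hx y hy =>
    lt_or_gt_of_ne fun he => hd hx (hf (hX hx) (hY hy) he ▸ hy)
  have sep : ∀ {X : Set ι}, KeyConvex f E X → ∀ y ∈ E, y ∉ X → ∀ a ∈ X, ∀ b ∈ X,
      ¬ (f a < f y ∧ f y < f b) := fun hX y hy hn a ha b hb h =>
    hn (hX a ha b hb y hy h.1 h.2)
  by_contra hcon
  rw [not_or] at hcon
  obtain ⟨h1, h2⟩ := hcon
  have h1' : ∃ a ∈ A, ∃ b ∈ B, ∃ c ∈ C, (f a < f c ∧ f c < f b) ∨ (f b < f c ∧ f c < f a) := by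
    simp only [KeyConvex] at h1
    push Not at h1
    obtain ⟨i, hi, j, hj, k, hk, hik, hkj, hn⟩ := h1
    have hkC : k ∈ C := by
      exact (h i (Or.inl hi) j (Or.inl hj) k hk hik hkj).resolve_left hn
    rcases hi with hi | hi <;> rcases hj with hj | hj
    · exact (hn (Or.inl (hA i hi j hj k hk hik hkj))).elim
    · exact ⟨i, hi, j, hj, k, hkC, Or.inl ⟨hik, hkj⟩⟩
    · exact ⟨j, hj, i, hi, k, hkC, Or.inr ⟨hik, hkj⟩⟩
    · exact (hn (Or.inr (hB i hi j hj k hk hik hkj))).elim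
  have h2' : ∃ a ∈ A, ∃ b ∈ B, ∃ c ∈ C, (f b < f a ∧ f a < f c) ∨ (f c < f a ∧ f a < f b) := by
    simp only [KeyConvex] at h2
    push Not at h2
    obtain ⟨i, hi, j, hj, k, hk, hik, hkj, hn⟩ := h2
    have hkA : k ∈ A := by
      have hi' : i ∈ A ∪ B ∪ C := by rcases hi with hi | hi <;> simp [hi]
      have hj' : j ∈ A ∪ B ∪ C := by rcases hj with hj | hj <;> simp [hj]
      have := h i hi' j hj' k hk hik hkj
      simp only [Set.mem_union] at this hn
      tauto
    rcases hi with hi | hi <;> rcases hj with hj | hj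
    · exact (hn (Or.inl (hB i hi j hj k hk hik hkj))).elim
    · exact ⟨k, hkA, i, hi, j, hj, Or.inl ⟨hik, hkj⟩⟩
    · exact ⟨k, hkA, j, hj, i, hi, Or.inr ⟨hik, hkj⟩⟩
    · exact (hn (Or.inr (hC i hi j hj k hk hik hkj))).elim
  obtain ⟨a, ha, b, hb, c, hc, h1⟩ := h1'
  obtain ⟨a', ha', b', hb', c', hc', h2⟩ := h2'
  -- The two failures use different points. If, say, `a < c < b` in the key order, then
  -- one-sidedness gives `a' < c < b'`, and then `a' < c'`; so `a'` is not between `b'` and `c'`.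
  have e1 := sep hA c (hCE hc) (fun h => hAC h hc) a ha a' ha'
  have e2 := sep hA c (hCE hc) (fun h => hAC h hc) a' ha' a ha
  have e3 := sep hB c (hCE hc) (hBC · hc) b hb b' hb'
  have e4 := sep hB c (hCE hc) (hBC · hc) b' hb' b hb
  have e5 := sep hC a (hAE ha) (hAC ha) c hc c' hc'
  have e6 := sep hC a (hAE ha) (hAC ha) c' hc' c hc
  have e7 := sep hC a' (hAE ha') (hAC ha') c hc c' hc'
  have e8 := sep hC a' (hAE ha') (hAC ha') c' hc' c hc
  have k1 := key hAE hCE hAC a' ha' c hc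
  have k2 := key hBE hCE hBC b' hb' c hc
  have k3 := key hAE hCE hAC a ha c' hc'
  omega

/-- A convex set lies on one side of any point outside it. -/
theorem forall_lt_or_forall_gt (hf : Set.InjOn f E) (hSE : S ⊆ E) (hS : KeyConvex f E S) {x : ι}
    (hx : x ∈ E) (hxS : x ∉ S) : (∀ i ∈ S, f x < f i) ∨ (∀ i ∈ S, f i < f x) := by
  by_contra! h
  obtain ⟨⟨i, hi, hix⟩, j, hj, hjx⟩ := h
  have ne : ∀ i ∈ S, f i ≠ f x := fun i hi h => hxS (hf (hSE hi) hx h ▸ hi)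
  exact hxS (hS i hi j hj x hx (lt_of_le_of_ne hix (ne i hi))
    (lt_of_le_of_ne hjx (ne j hj).symm))

end KeyConvex

/-! ### Segments of vertices: crossings and quadrilaterals -/

/-- The elements of `V` from `u` up to, but not including, `w`. -/
def segment (V : Finset ℕ) (u w : ℕ) : Set ℕ := {v | v ∈ V ∧ u ≤ v ∧ v < w}

theorem mem_segment {V : Finset ℕ} {u w v : ℕ} : v ∈ segment V u w ↔ v ∈ V ∧ u ≤ v ∧ v < w :=
  Iff.rfl

theorem segment_mono {V : Finset ℕ} {m u w M : ℕ} (h : m ≤ u) (h' : w ≤ M) :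
    segment V u w ⊆ segment V m M := fun _ hv => ⟨hv.1, h.trans hv.2.1, hv.2.2.trans_le h'⟩

theorem KeyConvex.segment_of_crossing {V : Finset ℕ} {f : ℕ → ℤ} {m M p q r s : ℕ}
    (hf : Set.InjOn f (segment V m M)) (hp : p ∈ V) (hq : q ∈ V) (hr : r ∈ V)
    (hmp : m ≤ p) (hpq : p < q) (hqr : q < r) (hrs : r < s) (hsM : s ≤ M)
    (h1 : KeyConvex f (segment V m M) (segment V p r))
    (h2 : KeyConvex f (segment V m M) (segment V q s)) :
    KeyConvex f (segment V m M) (segment V p q) ∧ KeyConvex f (segment V m M) (segment V q r) ∧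
      KeyConvex f (segment V m M) (segment V r s) ∧
      KeyConvex f (segment V m M) (segment V p s) := by
  have s1 : segment V p r ⊆ segment V m M := segment_mono hmp (by omega)
  have s2 : segment V q s ⊆ segment V m M := segment_mono (by omega) hsM
  have i1 : segment V p q = segment V p r \ segment V q s := by
    ext v; simp only [Set.mem_sdiff, mem_segment]; grind
  have i2 : segment V q r = segment V p r ∩ segment V q s := by
    ext v; simp only [Set.mem_inter_iff, mem_segment]; grind
  have i3 : segment V r s = segment V q s \ segment V p r := by
    ext v; simp only [Set.mem_sdiff, mem_segment]; grind
  have i4 : segment V p s = segment V p r ∪ segment V q s := by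
    ext v; simp only [Set.mem_union, mem_segment]; grind
  rw [i1, i2, i3, i4]
  refine ⟨h1.diff hf s1 s2 h2 ⟨r, ?_⟩, h1.inter h2, h2.diff hf s2 s1 h1 ⟨p, ?_⟩,
    h1.union hf s1 h2 ⟨q, ?_⟩⟩ <;>
  simp only [Set.mem_sdiff, Set.mem_inter_iff, mem_segment] <;> grind

theorem KeyConvex.segment_of_quadrilateral {V : Finset ℕ} {f : ℕ → ℤ} {m M p q r s : ℕ}
    (hf : Set.InjOn f (segment V m M))
    (hmp : m ≤ p) (hpq : p < q) (hqr : q < r) (hrs : r < s) (hsM : s ≤ M)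
    (h1 : KeyConvex f (segment V m M) (segment V p q))
    (h2 : KeyConvex f (segment V m M) (segment V q r))
    (h3 : KeyConvex f (segment V m M) (segment V r s))
    (h4 : KeyConvex f (segment V m M) (segment V p s)) :
    KeyConvex f (segment V m M) (segment V p r) ∨
      KeyConvex f (segment V m M) (segment V q s) := by
  have i1 : segment V p r = segment V p q ∪ segment V q r := by
    ext v; simp only [Set.mem_union, mem_segment]; grind
  have i2 : segment V q s = segment V q r ∪ segment V r s := by
    ext v; simp only [Set.mem_union, mem_segment]; grind
  have i3 : segment V p s = segment V p q ∪ segment V q r ∪ segment V r s := by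
    ext v; simp only [Set.mem_union, mem_segment]; grind
  rw [i1, i2]
  rw [i3] at h4
  refine KeyConvex.union_or_union hf (segment_mono (by omega) (by omega))
    (segment_mono (by omega) (by omega)) (segment_mono (by omega) (by omega)) h1 h2 h3
    ?_ ?_ h4 <;>
  · rw [Set.disjoint_left]
    intro v hv hv'
    simp only [mem_segment] at hv hv'
    omega

/-! ### Simple orders -/

/-- For `m ≥ 4` there is an order of `{0, …, m - 1}` without non-trivial intervals. -/
theorem exists_simple_order (m : ℕ) (hm : 4 ≤ m) : ∃ σ : ℕ → ℤ, Set.InjOn σ (Set.Iio m) ∧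
    (∀ v < m, 0 ≤ σ v ∧ σ v < 2 * m) ∧
    ∀ a b, a + 2 ≤ b → b ≤ m → (a, b) ≠ (0, m) →
      ∃ i j k, a ≤ i ∧ i < b ∧ a ≤ j ∧ j < b ∧ k < m ∧ (k < a ∨ b ≤ k) ∧
        σ i < σ k ∧ σ k < σ j := by
  -- The order is `1, 3, 5, …, 0, 2, 4, …`, except that for odd `m` the last even number `m - 1`
  -- moves to just after `0`. Without this move `{0, …, m - 2}` would be convex.
  let σ : ℕ → ℤ := fun v =>
    if v % 2 = 1 then v else if v = 0 then m else if v + 1 = m then m + 1 else m + v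
  have hodd : ∀ v, v % 2 = 1 → σ v = v := fun v hv => if_pos hv
  have hzero : σ 0 = m := by simp [σ]
  have hlast : ∀ v, v % 2 = 0 → v ≠ 0 → v + 1 = m → σ v = m + 1 := fun v h1 h2 h3 => by
    simp [σ, h1, h2, h3]
  have hev : ∀ v, v % 2 = 0 → v ≠ 0 → v + 1 ≠ m → σ v = m + v := fun v h1 h2 h3 => by
    simp [σ, h1, h2, h3]
  have hcases : ∀ v, (v % 2 = 1 ∧ σ v = v) ∨ (v = 0 ∧ σ v = m) ∨
      (v % 2 = 0 ∧ v ≠ 0 ∧ v + 1 = m ∧ σ v = m + 1) ∨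
      (v % 2 = 0 ∧ v ≠ 0 ∧ v + 1 ≠ m ∧ σ v = m + v) := by
    intro v
    rcases Nat.mod_two_eq_zero_or_one v with h | h
    · by_cases h0 : v = 0
      · subst h0; simp [hzero]
      · by_cases h1 : v + 1 = m
        · exact Or.inr (Or.inr (Or.inl ⟨h, h0, h1, hlast v h h0 h1⟩))
        · exact Or.inr (Or.inr (Or.inr ⟨h, h0, h1, hev v h h0 h1⟩))
    · exact Or.inl ⟨h, hodd v h⟩
  refine ⟨σ, ?_, ?_, ?_⟩
  · intro v hv w hw h
    simp only [Set.mem_Iio] at hv hw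
    have := hcases v
    have := hcases w
    omega
  · intro v hv
    have := hcases v
    omega
  · intro a b hab hbm hne
    -- The last two elements of the segment are an odd `o` and an even `e`; an outside element
    -- between them in the order is needed.
    obtain ⟨o, ho, hoa, hob⟩ : ∃ o, o % 2 = 1 ∧ b ≤ o + 2 ∧ o < b := by
      rcases Nat.mod_two_eq_zero_or_one b with h | h
      · exact ⟨b - 1, by omega, by omega, by omega⟩
      · exact ⟨b - 2, by omega, by omega, by omega⟩
    obtain ⟨e, he, hea, heb⟩ : ∃ o, o % 2 = 0 ∧ b ≤ o + 2 ∧ o < b := by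
      rcases Nat.mod_two_eq_zero_or_one b with h | h
      · exact ⟨b - 2, by omega, by omega, by omega⟩
      · exact ⟨b - 1, by omega, by omega, by omega⟩
    have co := hcases o
    have ce := hcases e
    rcases hbm.lt_or_eq with hb | rfl
    -- An odd number beyond `o` works. The exception is `b = m - 1` even, where `k = m - 1` comes
    -- after all odd numbers and before `e`; here `m ≥ 4` ensures `e ≠ 0`.
    · obtain ⟨k, hk⟩ : ∃ k, k = if b % 2 = 1 ∨ b + 1 = m then b else b + 1 := ⟨_, rfl⟩
      have ck := hcases k
      refine ⟨o, e, k, ?_⟩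
      split_ifs at hk <;> omega
    · have : a ≠ 0 := fun h => hne (by rw [h])
      exact ⟨o, e, 0, by omega⟩

theorem exists_simple_key {V : Finset ℕ} {x y : ℕ} (hx : x ∈ V)
    (hcard : 4 ≤ (V.filter fun v => x ≤ v ∧ v < y).card) :
    ∃ (g : ℕ → ℤ) (N : ℤ), Set.InjOn g (segment V x y) ∧ (∀ v ∈ segment V x y, |g v| < N) ∧
      ∀ u ∈ V, ∀ w ∈ V, x ≤ u → w ≤ y → (u, w) ≠ (x, y) → (∃ z ∈ V, u < z ∧ z < w) →
        ¬ KeyConvex g (segment V x y) (segment V u w) := by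
  set B := V.filter fun v => x ≤ v ∧ v < y with hB
  obtain ⟨σ, hinj, hbd, hσ⟩ := exists_simple_order B.card hcard
  -- The rank in the block transports the order of `{0, …, m - 1}` to it.
  let r : ℕ → ℕ := fun v => (B.filter (· < v)).card
  have hr : ∀ u ∈ B, ∀ v, u < v → r u < r v := by
    intro u hu v huv
    refine Finset.card_lt_card ⟨fun t ht => ?_, fun h => ?_⟩
    · simp only [Finset.mem_filter] at ht ⊢; exact ⟨ht.1, by omega⟩
    · have := h (Finset.mem_filter.2 ⟨hu, huv⟩)
      simp at this
  have hmemB : ∀ v, v ∈ B ↔ v ∈ segment V x y := fun v => by simp [hB, mem_segment]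
  have hrlt : ∀ u ∈ B, r u < B.card := by
    intro u hu
    refine Finset.card_lt_card ⟨Finset.filter_subset _ _, fun h => ?_⟩
    have := h hu
    simp at this
  have hrinj : ∀ u ∈ B, ∀ v ∈ B, r u = r v → u = v := by
    intro u hu v hv h
    rcases lt_trichotomy u v with h' | h' | h'
    · exact absurd h (hr u hu v h').ne
    · exact h'
    · exact absurd h (hr v hv u h').ne'
  have hsurj : ∀ k < B.card, ∃ v ∈ B, r v = k := by
    intro k hk
    have := Finset.surj_on_of_inj_on_of_card_le (s := B) (t := Finset.range B.card)
      (fun v _ => r v) (fun v hv => Finset.mem_range.2 (hrlt v hv))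
      (fun u v hu hv h => hrinj u hu v hv h) (by simp) k (Finset.mem_range.2 hk)
    obtain ⟨v, hv, h⟩ := this
    exact ⟨v, hv, h.symm⟩
  refine ⟨fun v => σ (r v), 2 * B.card, ?_, ?_, ?_⟩
  · intro u hu v hv h
    exact hrinj u ((hmemB u).2 hu) v ((hmemB v).2 hv)
      (hinj (hrlt u ((hmemB u).2 hu)) (hrlt v ((hmemB v).2 hv)) h)
  · intro v hv
    have := hbd _ (hrlt v ((hmemB v).2 hv))
    rw [abs_of_nonneg this.1]
    exact this.2
  · rintro u hu w hw hxu hwy hne ⟨z, hz, huz, hzw⟩ hconv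
    have huB : u ∈ B := (hmemB u).2 ⟨hu, hxu, by omega⟩
    have hzB : z ∈ B := (hmemB z).2 ⟨hz, by omega, by omega⟩
    have h1 := hr u huB z huz
    have h2 := hr z hzB w hzw
    have hwcard : r w ≤ B.card := Finset.card_filter_le _ _
    have hrw : ∀ v ∈ B, r v < r w → v < w := by
      intro v hv h
      by_contra! hwv
      rcases hwv.lt_or_eq with h' | h'
      · have hwB : w ∈ B := (hmemB w).2 ⟨hw, by omega, ((hmemB v).1 hv).2.2.trans' h'⟩
        have := hr w hwB v h'
        omega
      · subst h'; omega
    have hru : ∀ v ∈ B, r u ≤ r v → u ≤ v := by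
      intro v hv h
      by_contra! h'
      have := hr v hv u h'
      omega
    have hne' : (r u, r w) ≠ (0, B.card) := by
      intro h
      simp only [Prod.mk.injEq] at h
      apply hne
      have e1 : u = x := by
        by_contra hux
        have := hr x ((hmemB x).2 ⟨hx, le_rfl, by omega⟩) u (by omega)
        omega
      have e2 : w = y := by
        by_contra hwy'
        have := hrlt w ((hmemB w).2 ⟨hw, by omega, by omega⟩)
        omega
      rw [e1, e2]
    obtain ⟨i, j, k, hi, hi', hj, hj', hk, hk', hik, hkj⟩ :=
      hσ (r u) (r w) (by omega) hwcard hne'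
    obtain ⟨i, hiB, rfl⟩ := hsurj i (by omega)
    obtain ⟨j, hjB, rfl⟩ := hsurj j (by omega)
    obtain ⟨k, hkB, rfl⟩ := hsurj k hk
    have hmem : k ∈ segment V u w :=
      hconv i ⟨((hmemB i).1 hiB).1, hru i hiB hi, hrw i hiB hi'⟩
      j ⟨((hmemB j).1 hjB).1, hru j hjB hj, hrw j hjB hj'⟩ k ((hmemB k).1 hkB) hik hkj
    have a1 : r u ≤ r k := by
      rcases hmem.2.1.lt_or_eq with h | h
      · exact (hr u huB k h).le
      · rw [h]
    have a2 := hr k hkB w hmem.2.2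
    omega

/-! ### Framed relations and contraction -/

/-- The relation `C` on the vertices `V` is closed under crossings, joins consecutive vertices and
has no empty quadrilaterals. -/
structure IsFramedOn (C : ℕ → ℕ → Prop) (V : Finset ℕ) : Prop where
  crossing : ∀ p ∈ V, ∀ q ∈ V, ∀ r ∈ V, ∀ s ∈ V, p < q → q < r → r < s → C p r → C q s →
    C p q ∧ C q r ∧ C r s ∧ C p s
  quadrilateral : ∀ p ∈ V, ∀ q ∈ V, ∀ r ∈ V, ∀ s ∈ V, p < q → q < r → r < s →
    C p q → C q r → C r s → C p s → C p r ∨ C q s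
  consecutive : ∀ p ∈ V, ∀ q ∈ V, p < q → (∀ z ∈ V, ¬ (p < z ∧ z < q)) → C p q

/-- The key `f` orders the vertices of `V` in `[m, M)` in such a way that the convex segments are
exactly those given by `C`. -/
structure Realizes (C : ℕ → ℕ → Prop) (V : Finset ℕ) (m M : ℕ) (f : ℕ → ℤ) : Prop where
  injOn : Set.InjOn f (segment V m M)
  convex_iff : ∀ u ∈ V, ∀ w ∈ V, u < w → (C u w ↔ KeyConvex f (segment V m M) (segment V u w))

/-- `V` without the vertices strictly between `x` and `y`. -/
def contract (V : Finset ℕ) (x y : ℕ) : Finset ℕ := V.filter fun v => ¬ (x < v ∧ v < y)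

theorem mem_contract {V : Finset ℕ} {x y v : ℕ} :
    v ∈ contract V x y ↔ v ∈ V ∧ ¬ (x < v ∧ v < y) := Finset.mem_filter

/-- The only pair that can become consecutive by the deletion is `x`, `y`, which is joined by
assumption. -/
theorem IsFramedOn.contract_of {C : ℕ → ℕ → Prop} {V : Finset ℕ} (h : IsFramedOn C V) {x y : ℕ}
    (hxy : x < y) (hx : x ∈ V) (hy : y ∈ V) (hC : C x y) :
    IsFramedOn C (contract V x y) where
  crossing p hp q hq r hr s hs := h.crossing p (mem_contract.1 hp).1 q (mem_contract.1 hq).1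
    r (mem_contract.1 hr).1 s (mem_contract.1 hs).1
  quadrilateral p hp q hq r hr s hs := h.quadrilateral p (mem_contract.1 hp).1
    q (mem_contract.1 hq).1 r (mem_contract.1 hr).1 s (mem_contract.1 hs).1
  consecutive p hp q hq hpq hno := by
    rw [mem_contract] at hp hq
    by_cases hz : ∀ z ∈ V, ¬ (p < z ∧ z < q)
    · exact h.consecutive p hp.1 q hq.1 hpq hz
    · push Not at hz
      obtain ⟨z, hzV, h1, h2⟩ := hz
      have hzin : x < z ∧ z < y := by
        by_contra hn
        exact hno z (mem_contract.2 ⟨hzV, hn⟩) ⟨h1, h2⟩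
      have hx' := hno x (mem_contract.2 ⟨hx, by omega⟩)
      have hy' := hno y (mem_contract.2 ⟨hy, by omega⟩)
      obtain rfl : p = x := by omega
      obtain rfl : q = y := by omega
      exact hC

/-! ### Inflation of an element -/

/-- Replace the element `x` of the order given by `f` by the elements of `[x, y)`, ordered
by `g`. -/
def inflate (x y : ℕ) (N : ℤ) (f g : ℕ → ℤ) (v : ℕ) : ℤ :=
  N * f (if x ≤ v ∧ v < y then x else v) + g v

section inflate

variable {V : Finset ℕ} {m M x y : ℕ} {N : ℤ} {f g : ℕ → ℤ}

/-- Integer values of `f` that differ give a gap of at least `N`. At most one of the two points lies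
in the block, so at most one correction `g` is nonzero, and it is smaller than `N`. -/
theorem inflate_lt (hg : ∀ v ∈ segment V m M, |g v| < N)
    (hg0 : ∀ v, ¬ (x ≤ v ∧ v < y) → g v = 0) {i j : ℕ}
    (hi : i ∈ segment V m M) (hj : j ∈ segment V m M)
    (hsep : (i < x ∨ y ≤ i) ∨ (j < x ∨ y ≤ j))
    (h : f (if x ≤ i ∧ i < y then x else i) < f (if x ≤ j ∧ j < y then x else j)) :
    inflate x y N f g i < inflate x y N f g j := by
  have h1 := abs_lt.1 (hg i hi)
  have h2 := abs_lt.1 (hg j hj)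
  unfold inflate
  have h3 : 0 ≤ N := by linarith
  have h4 : N * f (if x ≤ i ∧ i < y then x else i) + N ≤
      N * f (if x ≤ j ∧ j < y then x else j) := by
    nlinarith
  rcases hsep with h | h
  · have := hg0 i (by omega); linarith
  · have := hg0 j (by omega); linarith

theorem inflate_of_notMem (hg0 : ∀ v, ¬ (x ≤ v ∧ v < y) → g v = 0) {i : ℕ}
    (h : ¬ (x ≤ i ∧ i < y)) : inflate x y N f g i = N * f i := by
  simp [inflate, h, hg0 i h]

theorem inflate_of_mem {i : ℕ} (h : x ≤ i ∧ i < y) :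
    inflate x y N f g i = N * f x + g i := by
  simp [inflate, h]

theorem repr_mem_contract (hx : x ∈ V) (hxy : x < y) (hmx : m ≤ x) (hyM : y ≤ M) {i : ℕ}
    (hi : i ∈ segment V m M) :
    (if x ≤ i ∧ i < y then x else i) ∈ segment (contract V x y) m M := by
  rw [mem_segment] at hi
  rw [mem_segment, mem_contract]
  split_ifs with h
  · exact ⟨⟨hx, by omega⟩, by omega⟩
  · exact ⟨⟨hi.1, by omega⟩, by omega⟩

theorem inflate_injOn (hx : x ∈ V) (hxy : x < y) (hmx : m ≤ x) (hyM : y ≤ M)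
    (hf : Set.InjOn f (segment (contract V x y) m M))
    (hg : ∀ v ∈ segment V m M, |g v| < N) (hg0 : ∀ v, ¬ (x ≤ v ∧ v < y) → g v = 0)
    (hginj : Set.InjOn g (segment V x y)) :
    Set.InjOn (inflate x y N f g) (segment V m M) := by
  intro i hi j hj h
  have hi' := repr_mem_contract hx hxy hmx hyM hi
  have hj' := repr_mem_contract hx hxy hmx hyM hj
  by_cases hsep : (i < x ∨ y ≤ i) ∨ (j < x ∨ y ≤ j)
  · rcases lt_trichotomy (f (if x ≤ i ∧ i < y then x else i))
      (f (if x ≤ j ∧ j < y then x else j)) with h1 | h1 | h1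
    · exact absurd h (inflate_lt hg hg0 hi hj hsep h1).ne
    · have := hf hi' hj' h1
      split_ifs at this <;> omega
    · exact absurd h (inflate_lt hg hg0 hj hi hsep.symm h1).ne'
  · have a1 : x ≤ i ∧ i < y := by omega
    have a2 : x ≤ j ∧ j < y := by omega
    rw [inflate_of_mem a1, inflate_of_mem a2] at h
    exact hginj ⟨hi.1, a1⟩ ⟨hj.1, a2⟩ (by linarith)

/-- Neither end is strictly inside the block, so the segment contains all of the block or none of
it, and `x` can represent the block. -/
theorem keyConvex_inflate_iff (hx : x ∈ V) (hxy : x < y) (hmx : m ≤ x)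
    (hyM : y ≤ M) (hf : Set.InjOn f (segment (contract V x y) m M))
    (hg : ∀ v ∈ segment V m M, |g v| < N) (hg0 : ∀ v, ¬ (x ≤ v ∧ v < y) → g v = 0) {u w : ℕ}
    (hu : u ∈ contract V x y) (hw : w ∈ contract V x y) (hmu : m ≤ u) (hwM : w ≤ M) :
    KeyConvex (inflate x y N f g) (segment V m M) (segment V u w) ↔
      KeyConvex f (segment (contract V x y) m M) (segment (contract V x y) u w) := by
  rw [mem_contract] at hu hw
  have hsat : ∀ i, (u ≤ (if x ≤ i ∧ i < y then x else i) ∧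
      (if x ≤ i ∧ i < y then x else i) < w) ↔ u ≤ i ∧ i < w := by
    intro i; split_ifs <;> omega
  have hid : ∀ i ∈ contract V x y, (if x ≤ i ∧ i < y then x else i) = i := by
    intro i hi
    rw [mem_contract] at hi
    split_ifs <;> omega
  have hlt : ∀ i ∈ segment V m M, ∀ j ∈ segment V m M,
      f (if x ≤ i ∧ i < y then x else i) < f (if x ≤ j ∧ j < y then x else j) →
      inflate x y N f g i < inflate x y N f g j := by
    intro i hi j hj h
    refine inflate_lt hg hg0 hi hj ?_ h
    by_contra hn
    rw [if_pos (by omega), if_pos (by omega)] at h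
    exact lt_irrefl _ h
  constructor
  · intro h i hi j hj k hk h1 h2
    have mem : ∀ {a b v}, v ∈ segment (contract V x y) a b → v ∈ segment V a b :=
      fun hv => ⟨(mem_contract.1 hv.1).1, hv.2⟩
    have hi' := segment_mono hmu hwM (mem hi)
    have hj' := segment_mono hmu hwM (mem hj)
    have hk' := mem hk
    refine ⟨hk.1, (h i (mem hi) j (mem hj) k hk' (hlt _ hi' _ hk' ?_)
      (hlt _ hk' _ hj' ?_)).2⟩
    · rwa [hid i hi.1, hid k hk.1]
    · rwa [hid j hj.1, hid k hk.1]
  · intro h i hi j hj k hk h1 h2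
    have hi' := segment_mono hmu hwM hi
    have hj' := segment_mono hmu hwM hj
    have ri := repr_mem_contract hx hxy hmx hyM hi'
    have rj := repr_mem_contract hx hxy hmx hyM hj'
    have rk := repr_mem_contract hx hxy hmx hyM hk
    refine ⟨hk.1, (hsat k).1 ?_⟩
    rcases lt_trichotomy (f (if x ≤ i ∧ i < y then x else i))
      (f (if x ≤ k ∧ k < y then x else k)) with e1 | e1 | e1
    · rcases lt_trichotomy (f (if x ≤ k ∧ k < y then x else k))
        (f (if x ≤ j ∧ j < y then x else j)) with e2 | e2 | e2
      · exact (h _ ⟨ri.1, (hsat i).2 hi.2⟩ _ ⟨rj.1, (hsat j).2 hj.2⟩ _ rk e1 e2).2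
      · rw [hf rk rj e2]; exact (hsat j).2 hj.2
      · exact absurd (hlt _ hj' _ hk e2) h2.not_gt
    · rw [← hf ri rk e1]; exact (hsat i).2 hi.2
    · exact absurd (hlt _ hk _ hi' e1) h1.not_gt

theorem KeyConvex.of_inflate (hmx : m ≤ x) (hyM : y ≤ M) {u w : ℕ} (hxu : x ≤ u) (hwy : w ≤ y)
    (h : KeyConvex (inflate x y N f g) (segment V m M) (segment V u w)) :
    KeyConvex g (segment V x y) (segment V u w) := by
  intro i hi j hj k hk h1 h2
  refine h i hi j hj k (segment_mono hmx hyM hk) ?_ ?_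
  · rw [inflate_of_mem ⟨hxu.trans hi.2.1, hi.2.2.trans_le hwy⟩, inflate_of_mem hk.2]
    linarith
  · rw [inflate_of_mem ⟨hxu.trans hj.2.1, hj.2.2.trans_le hwy⟩, inflate_of_mem hk.2]
    linarith

end inflate

theorem KeyConvex.segment_of_consecutive {V : Finset ℕ} {f : ℕ → ℤ} {E : Set ℕ} {u w : ℕ}
    (hno : ∀ z ∈ V, ¬ (u < z ∧ z < w)) : KeyConvex f E (segment V u w) := by
  rintro i hi j hj k - h1 h2
  have := hno i hi.1
  have := hno j hj.1
  obtain rfl : i = u := by have := hi.2; omega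
  obtain rfl : j = i := by have := hj.2; omega
  exact absurd h1 h2.not_gt

/-- Inflation of an element by a simple order. -/
theorem Realizes.inflate_simple {C : ℕ → ℕ → Prop} {V : Finset ℕ} {m M x y : ℕ} {N : ℤ}
    {f g : ℕ → ℤ} (hV : ∀ v ∈ V, m ≤ v ∧ v ≤ M) (hC : IsFramedOn C V)
    (hx : x ∈ V) (hy : y ∈ V) (hxy : x < y) (hCxy : C x y)
    (hmin : ∀ u ∈ V, ∀ w ∈ V, x ≤ u → w ≤ y → (u, w) ≠ (x, y) → (∃ z ∈ V, u < z ∧ z < w) →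
      ¬ C u w)
    (htwo : ∃ z₁ ∈ V, ∃ z₂ ∈ V, x < z₁ ∧ z₁ < z₂ ∧ z₂ < y)
    (hf : Realizes C (contract V x y) m M f)
    (hg : ∀ v ∈ segment V m M, |g v| < N) (hg0 : ∀ v, ¬ (x ≤ v ∧ v < y) → g v = 0)
    (hginj : Set.InjOn g (segment V x y))
    (hsimple : ∀ u ∈ V, ∀ w ∈ V, x ≤ u → w ≤ y → (u, w) ≠ (x, y) → (∃ z ∈ V, u < z ∧ z < w) →
        ¬ KeyConvex g (segment V x y) (segment V u w)) :
    Realizes C V m M (inflate x y N f g) := by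
  have hmx := (hV x hx).1
  have hyM := (hV y hy).2
  have hinj := inflate_injOn hx hxy hmx hyM hf.injOn hg hg0 hginj
  have hout : ∀ u ∈ contract V x y, ∀ w ∈ contract V x y, u < w →
      (C u w ↔ KeyConvex (inflate x y N f g) (segment V m M) (segment V u w)) := by
    intro u hu w hw huw
    rw [keyConvex_inflate_iff hx hxy hmx hyM hf.injOn hg hg0 hu hw
      (hV u (mem_contract.1 hu).1).1 (hV w (mem_contract.1 hw).1).2]
    exact hf.convex_iff u hu w hw huw
  have hxc : x ∈ contract V x y := mem_contract.2 ⟨hx, by omega⟩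
  have hyc : y ∈ contract V x y := mem_contract.2 ⟨hy, by omega⟩
  have hin : ∀ u ∈ V, ∀ w ∈ V, u < w → x ≤ u → w ≤ y →
      (C u w ↔ KeyConvex (inflate x y N f g) (segment V m M) (segment V u w)) := by
    intro u hu w hw huw hxu hwy
    by_cases he : (u, w) = (x, y)
    · simp only [Prod.mk.injEq] at he
      rw [he.1, he.2]
      exact hout x hxc y hyc hxy
    by_cases hz : ∃ z ∈ V, u < z ∧ z < w
    · exact iff_of_false (hmin u hu w hw hxu hwy he hz)
        fun h => hsimple u hu w hw hxu hwy he hz (h.of_inflate hmx hyM hxu hwy)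
    · push Not at hz
      have hz' : ∀ z ∈ V, ¬ (u < z ∧ z < w) := fun z hzV h => absurd h.2 (hz z hzV h.1).not_gt
      exact iff_of_true (hC.consecutive u hu w hw huw hz') (.segment_of_consecutive hz')
  obtain ⟨z₁, hz₁, z₂, hz₂, h1, h2, h3⟩ := htwo
  -- With two vertices inside, one of the chords `{x, t}`, `{t, y}` still has a vertex inside,
  -- against minimality. A chord, or a convex segment, that crosses `{x, y}` would produce both of
  -- them.
  have hno : ∀ t ∈ V, x < t → t < y → ¬ (C x t ∧ C t y) := by
    rintro t ht hxt hty ⟨a, b⟩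
    by_cases hlt : z₁ < t
    · exact hmin x hx t ht le_rfl hty.le (by simp; omega) ⟨z₁, hz₁, h1, hlt⟩ a
    · exact hmin t ht y hy hxt.le le_rfl (by simp; omega) ⟨z₂, hz₂, by omega, h3⟩ b
  have hxyc := (hout x hxc y hyc hxy).1 hCxy
  refine ⟨hinj, fun u hu w hw huw => ?_⟩
  by_cases huc : x < u ∧ u < y
  · by_cases hwy : w ≤ y
    · exact hin u hu w hw huw huc.1.le hwy
    · refine iff_of_false (fun h => ?_) fun h => ?_
      · obtain ⟨a, b, -⟩ := hC.crossing x hx u hu y hy w hw huc.1 huc.2 (by omega) hCxy h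
        exact hno u hu huc.1 huc.2 ⟨a, b⟩
      · obtain ⟨a, b, -⟩ := KeyConvex.segment_of_crossing hinj hx hu hy hmx huc.1 huc.2
          (by omega) (hV w hw).2 hxyc h
        exact hno u hu huc.1 huc.2 ⟨(hin x hx u hu huc.1 le_rfl huc.2.le).2 a,
          (hin u hu y hy huc.2 huc.1.le le_rfl).2 b⟩
  · by_cases hwc : x < w ∧ w < y
    · by_cases hxu : x ≤ u
      · exact hin u hu w hw huw hxu hwc.2.le
      · refine iff_of_false (fun h => ?_) fun h => ?_
        · obtain ⟨-, a, b, -⟩ := hC.crossing u hu x hx w hw y hy (by omega) hwc.1 hwc.2 h hCxy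
          exact hno w hw hwc.1 hwc.2 ⟨a, b⟩
        · obtain ⟨-, a, b, -⟩ := KeyConvex.segment_of_crossing hinj hu hx hw (hV u hu).1
            (by omega) hwc.1 hwc.2 hyM h hxyc
          exact hno w hw hwc.1 hwc.2 ⟨(hin x hx w hw hwc.1 le_rfl hwc.2.le).2 a,
            (hin w hw y hy hwc.2 hwc.1.le le_rfl).2 b⟩
    · exact hout u (mem_contract.2 ⟨hu, huc⟩) w (mem_contract.2 ⟨hw, hwc⟩) huw

/-! ### Inflation by a pair -/

theorem keyConvex_neg {ι : Type*} {f : ι → ℤ} {E S : Set ι} :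
    KeyConvex (fun i => -f i) E S ↔ KeyConvex f E S :=
  ⟨fun h i hi j hj k hk h1 h2 => h j hj i hi k hk (by simpa using h2) (by simpa using h1),
    fun h i hi j hj k hk h1 h2 => h j hj i hi k hk (by simpa using h2) (by simpa using h1)⟩

section insert

variable {ι : Type*} {f F : ι → ℤ} {E₁ W : Set ι} {x z : ι}

/-- Doubling `f` leaves room for `z` immediately after `x`. Then `z` touches `W`, while it separates
`x` from `W`. -/
theorem keyConvex_insert_of_above (hz : z ∉ E₁) (hx : x ∈ E₁) (hW : W ⊆ E₁) (hxW : x ∉ W)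
    (hne : W.Nonempty) (hF : ∀ i ∈ E₁, F i = 2 * f i) (hFz : F z = 2 * f x + 1)
    (hconv : KeyConvex f E₁ (insert x W)) (hside : ∀ i ∈ W, f x < f i) :
    KeyConvex F (insert z E₁) (insert z W) ∧ ¬ KeyConvex F (insert z E₁) (insert x W) := by
  obtain ⟨t, ht⟩ := hne
  have hFx := hF x hx
  refine ⟨fun i hi j hj k hk hik hkj => ?_, fun h => ?_⟩
  · rcases hk with rfl | hk
    · simp
    have hFk := hF k hk
    have hxk : f x < f k := by
      rcases hi with rfl | hi
      · omega
      · have := hF i (hW hi)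
        have := hside i hi
        omega
    rcases hj with rfl | hj
    · omega
    · have := hF j (hW hj)
      rcases hconv x (by simp) j (by simp [hj]) k hk hxk (by omega) with rfl | h
      · omega
      · exact Or.inr h
  · have hFt := hF t (hW ht)
    have := hside t ht
    rcases h x (by simp) t (by simp [ht]) z (by simp) (by omega) (by omega) with rfl | h
    · exact hz hx
    · exact hz (hW h)

theorem keyConvex_insert_of_below (hz : z ∉ E₁) (hx : x ∈ E₁) (hW : W ⊆ E₁) (hxW : x ∉ W)
    (hne : W.Nonempty) (hF : ∀ i ∈ E₁, F i = 2 * f i) (hFz : F z = 2 * f x - 1)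
    (hconv : KeyConvex f E₁ (insert x W)) (hside : ∀ i ∈ W, f x < f i) :
    ¬ KeyConvex F (insert z E₁) (insert z W) ∧ KeyConvex F (insert z E₁) (insert x W) := by
  obtain ⟨t, ht⟩ := hne
  have hFx := hF x hx
  refine ⟨fun h => ?_, fun i hi j hj k hk hik hkj => ?_⟩
  · have hFt := hF t (hW ht)
    have := hside t ht
    rcases h z (by simp) t (by simp [ht]) x (by simp [hx]) (by omega) (by omega) with rfl | h
    · exact hz hx
    · exact hxW h
  · have hFi : ∀ i ∈ insert x W, F i = 2 * f i := by
      rintro i (rfl | hi)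
      · exact hFx
      · exact hF i (hW hi)
    have h1 := hFi i hi
    have h2 := hFi j hj
    rcases hk with rfl | hk
    · rcases hi with rfl | hi
      · omega
      · have := hside i hi
        omega
    · have := hF k hk
      exact hconv i hi j hj k hk (by omega) (by omega)

open Classical in
/-- An element `x` of an order is replaced by two neighbours `x` and `z`; a convex set `W` next to
`x` is next to exactly one of them. -/
theorem keyConvex_insert_iff {σ up : Prop}
    (hz : z ∉ E₁) (hx : x ∈ E₁) (hW : W ⊆ E₁) (hxW : x ∉ W)
    (hne : W.Nonempty) (hF : ∀ i ∈ E₁, F i = 2 * f i) (hFz : F z = 2 * f x + if σ then 1 else -1)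
    (hconv : KeyConvex f E₁ (insert x W))
    (hside : (up ∧ ∀ i ∈ W, f x < f i) ∨ (¬ up ∧ ∀ i ∈ W, f i < f x)) :
    (KeyConvex F (insert z E₁) (insert z W) ↔ (σ ↔ up)) ∧
      (KeyConvex F (insert z E₁) (insert x W) ↔ (σ ↔ ¬ up)) := by
  rcases hside with ⟨hup, hs⟩ | ⟨hup, hs⟩
  · by_cases hσ : σ
    · rw [if_pos hσ] at hFz
      have := keyConvex_insert_of_above hz hx hW hxW hne hF hFz hconv hs
      simp [hσ, hup, this.1, this.2]
    · rw [if_neg hσ] at hFz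
      have := keyConvex_insert_of_below hz hx hW hxW hne hF (by omega) hconv hs
      simp [hσ, hup, this.1, this.2]
  · rw [← keyConvex_neg, ← keyConvex_neg (f := F) (S := insert x W)]
    rw [← keyConvex_neg] at hconv
    have hF' : ∀ i ∈ E₁, (fun i => -F i) i = 2 * (fun i => -f i) i := fun i hi => by
      have := hF i hi
      dsimp only
      omega
    have hs' : ∀ i ∈ W, (fun i => -f i) x < (fun i => -f i) i := fun i hi => by
      have := hs i hi
      dsimp only
      omega
    by_cases hσ : σ
    · rw [if_pos hσ] at hFz
      have hFz' : (fun i => -F i) z = 2 * (fun i => -f i) x - 1 := by dsimp only; omega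
      have := keyConvex_insert_of_below hz hx hW hxW hne hF' hFz' hconv hs'
      simp [hσ, hup, this.1, this.2]
    · rw [if_neg hσ] at hFz
      have hFz' : (fun i => -F i) z = 2 * (fun i => -f i) x + 1 := by dsimp only; omega
      have := keyConvex_insert_of_above hz hx hW hxW hne hF' hFz' hconv hs'
      simp [hσ, hup, this.1, this.2]

end insert

/-- The order of a new vertex `z` next to `x` can be chosen consistently with `C`. -/
theorem exists_side {C : ℕ → ℕ → Prop} {V : Finset ℕ} {m M x z y : ℕ} {f : ℕ → ℤ}
    (hV : ∀ v ∈ V, m ≤ v ∧ v ≤ M) (hC : IsFramedOn C V)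
    (hx : x ∈ V) (hz : z ∈ V) (hy : y ∈ V) (hxz : x < z) (hzy : z < y)
    (hf : Realizes C (contract V x y) m M f) :
    ∃ σ : Prop, (∀ w ∈ V, y < w → C x w → C y w → (C z w ↔ (σ ↔ f x < f y))) ∧
      ∀ u ∈ V, u < x → C u x → C u y → (C u z ↔ (σ ↔ ¬ f x < f u)) := by
  have mem : ∀ v ∈ V, v ≤ x ∨ y ≤ v → v ∈ contract V x y :=
    fun v hv h => mem_contract.2 ⟨hv, by omega⟩
  have hmx := (hV x hx).1
  have hyM := (hV y hy).2
  have hxc := mem x hx (by omega)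
  have hyc := mem y hy (by omega)
  -- All conditions on `σ` must agree: those from the right with each other, those from the left
  -- with each other, and one side with the other. In the last case `x` lies between `u` and `y` in
  -- the order.
  have right : ∀ w ∈ V, ∀ w' ∈ V, y < w → w < w' → C x w → C y w → C x w' → C y w' →
      (C z w ↔ C z w') := by
    intro w hw w' hw' hyw hww h1 h2 h3 h4
    exact ⟨fun h => (hC.crossing z hz y hy w hw w' hw' hzy hyw hww h h4).2.2.2,
      fun h => (hC.crossing x hx z hz w hw w' hw' hxz (by omega) hww h1 h).2.1⟩
  have left : ∀ u ∈ V, ∀ u' ∈ V, u < x → u' < u → C u x → C u y → C u' x → C u' y →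
      ((C u z ↔ C u' z) ∧ (f x < f u ↔ f x < f u')) := by
    intro u hu u' hu' hux huu h1 h2 h3 h4
    refine ⟨⟨fun h => (hC.crossing u' hu' u hu x hx z hz huu hux hxz h3 h).2.2.2,
      fun h => (hC.crossing u' hu' u hu z hz y hy huu (by omega) hzy h h2).2.1⟩, ?_⟩
    have hu'c := mem u' hu' (by omega)
    have huc := mem u hu (by omega)
    have hconv := (hf.convex_iff u' hu'c x hxc (by omega)).1 h3
    have hside := hconv.forall_lt_or_forall_gt (x := x) hf.injOn
      (segment_mono (hV u' hu').1 (by omega)) ⟨hxc, by omega⟩ (by simp [mem_segment])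
    have a1 : u ∈ segment (contract V x y) u' x := ⟨huc, by omega⟩
    have a2 : u' ∈ segment (contract V x y) u' x := ⟨hu'c, by omega⟩
    rcases hside with h | h
    · simp [h u a1, h u' a2]
    · simp [(h u a1).not_gt, (h u' a2).not_gt]
  have both : ∀ w ∈ V, ∀ u ∈ V, y < w → u < x → C x w → C y w → C u x → C u y →
      ((C u z ↔ C z w) ∧ (f x < f u ↔ ¬ f x < f y)) := by
    intro w hw u hu hyw hux h1 h2 h3 h4
    refine ⟨⟨fun h => (hC.crossing u hu x hx z hz w hw hux hxz (by omega) h h1).2.2.1,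
      fun h => (hC.crossing u hu z hz y hy w hw (by omega) hzy hyw h4 h).1⟩, ?_⟩
    have huc := mem u hu (by omega)
    have hwc := mem w hw (by omega)
    have hmu := (hV u hu).1
    have hwM := (hV w hw).2
    have c1 := (hf.convex_iff u huc y hyc (by omega)).1 h4
    have c2 := (hf.convex_iff x hxc w hwc (by omega)).1 h1
    have xE : x ∈ segment (contract V x y) m M := ⟨hxc, by omega⟩
    have uE : u ∈ segment (contract V x y) m M := ⟨huc, by omega⟩
    have yE : y ∈ segment (contract V x y) m M := ⟨hyc, by omega⟩
    have nux : f u ≠ f x := fun h => by have := hf.injOn uE xE h; omega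
    have nyx : f y ≠ f x := fun h => by have := hf.injOn yE xE h; omega
    have nuy : f u ≠ f y := fun h => by have := hf.injOn uE yE h; omega
    have x1 : x ∈ segment (contract V x y) u y := ⟨hxc, by omega⟩
    have u1 : u ∈ segment (contract V x y) u y := ⟨huc, by omega⟩
    have x2 : x ∈ segment (contract V x y) x w := ⟨hxc, by omega⟩
    have y2 : y ∈ segment (contract V x y) x w := ⟨hyc, by omega⟩
    have yn : y ∉ segment (contract V x y) u y := by simp [mem_segment]
    have un : u ∉ segment (contract V x y) x w := by simp [mem_segment, hux]
    have e1 := fun a b => yn (c1 x x1 u u1 y yE a b)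
    have e2 := fun a b => yn (c1 u u1 x x1 y yE a b)
    have e3 := fun a b => un (c2 x x2 y y2 u uE a b)
    have e4 := fun a b => un (c2 y y2 x x2 u uE a b)
    grind
  -- One witness determines `σ`; without witnesses any choice works.
  by_cases hP : ∃ w ∈ V, y < w ∧ C x w ∧ C y w
  · obtain ⟨w, hw, hyw, h1, h2⟩ := hP
    refine ⟨C z w ↔ f x < f y, fun w' hw' hyw' h3 h4 => ?_, fun u hu hux h3 h4 => ?_⟩
    · have : C z w ↔ C z w' := by
        rcases lt_trichotomy w w' with h | rfl | h
        · exact right w hw w' hw' hyw h h1 h2 h3 h4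
        · rfl
        · exact (right w' hw' w hw hyw' h h3 h4 h1 h2).symm
      tauto
    · have := both w hw u hu hyw hux h1 h2 h3 h4
      tauto
  by_cases hQ : ∃ u ∈ V, u < x ∧ C u x ∧ C u y
  · obtain ⟨u, hu, hux, h1, h2⟩ := hQ
    refine ⟨C u z ↔ ¬ f x < f u, fun w' hw' hyw' h3 h4 => (hP ⟨w', hw', hyw', h3, h4⟩).elim,
      fun u' hu' hux' h3 h4 => ?_⟩
    have : (C u z ↔ C u' z) ∧ (f x < f u ↔ f x < f u') := by
      rcases lt_trichotomy u u' with h | rfl | h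
      · have := left u' hu' u hu hux' h h3 h4 h1 h2
        exact ⟨this.1.symm, this.2.symm⟩
      · exact ⟨Iff.rfl, Iff.rfl⟩
      · exact left u hu u' hu' hux h h1 h2 h3 h4
    tauto
  · exact ⟨True, fun w hw hyw h3 h4 => (hP ⟨w, hw, hyw, h3, h4⟩).elim,
      fun u hu hux h3 h4 => (hQ ⟨u, hu, hux, h3, h4⟩).elim⟩

open Classical in
/-- Inflation of an element by a pair. -/
theorem Realizes.exists_inflate_pair {C : ℕ → ℕ → Prop} {V : Finset ℕ} {m M x z y : ℕ}
    {f : ℕ → ℤ} (hV : ∀ v ∈ V, m ≤ v ∧ v ≤ M) (hC : IsFramedOn C V)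
    (hx : x ∈ V) (hz : z ∈ V) (hy : y ∈ V) (hxz : x < z) (hzy : z < y) (hCxy : C x y)
    (honly : ∀ t ∈ V, x < t → t < y → t = z) (hf : Realizes C (contract V x y) m M f) :
    ∃ F, Realizes C V m M F := by
  obtain ⟨σ, hright, hleft⟩ := exists_side hV hC hx hz hy hxz hzy hf
  let g : ℕ → ℤ := fun v => if v = z then (if σ then 1 else -1) else 0
  have hmx := (hV x hx).1
  have hyM := (hV y hy).2
  have hxy : x < y := hxz.trans hzy
  have hg : ∀ v ∈ segment V m M, |g v| < 2 := by
    intro v _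
    simp only [g]
    split_ifs <;> simp
  have hg0 : ∀ v, ¬ (x ≤ v ∧ v < y) → g v = 0 := by
    intro v hv
    exact if_neg (by omega)
  have hgz : g z = if σ then 1 else -1 := if_pos rfl
  have hginj : Set.InjOn g (segment V x y) := by
    have key : ∀ v ∈ segment V x y, v = x ∨ v = z := by
      intro v hv
      by_cases h : x < v
      · exact Or.inr (honly v hv.1 h hv.2.2)
      · have := hv.2; omega
    have hgx : g x = 0 := if_neg hxz.ne
    have hgz' : g z ≠ 0 := by rw [hgz]; split_ifs <;> simp
    intro u hu v hv h
    rcases key u hu with rfl | rfl <;> rcases key v hv with rfl | rfl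
    · rfl
    · exact absurd (h.symm.trans hgx) hgz'
    · exact absurd (h.trans hgx) hgz'
    · rfl
  have hinj := inflate_injOn hx hxy hmx hyM hf.injOn hg hg0 hginj
  have hmem : ∀ v, v ∈ contract V x y ↔ v ∈ V ∧ v ≠ z := by
    intro v
    rw [mem_contract]
    refine and_congr_right fun hv => ⟨fun h h' => h (by omega), fun h h' => h ?_⟩
    exact honly v hv h'.1 h'.2
  refine ⟨inflate x y 2 f g, hinj, ?_⟩
  have hout : ∀ u ∈ V, ∀ w ∈ V, u ≠ z → w ≠ z → u < w →
      (C u w ↔ KeyConvex (inflate x y 2 f g) (segment V m M) (segment V u w)) := by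
    intro u hu w hw huz hwz huw
    have huc := (hmem u).2 ⟨hu, huz⟩
    have hwc := (hmem w).2 ⟨hw, hwz⟩
    rw [keyConvex_inflate_iff hx hxy hmx hyM hf.injOn hg hg0 huc hwc (hV u hu).1 (hV w hw).2]
    exact hf.convex_iff u huc w hwc huw
  have hxc := (hmem x).2 ⟨hx, hxz.ne⟩
  have hyc := (hmem y).2 ⟨hy, hzy.ne'⟩
  have hE : segment V m M = insert z (segment (contract V x y) m M) := by
    ext v
    simp only [Set.mem_insert_iff, mem_segment, hmem]
    constructor
    · intro h
      by_cases hvz : v = z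
      · exact Or.inl hvz
      · exact Or.inr ⟨⟨h.1, hvz⟩, h.2⟩
    · rintro (rfl | h)
      · exact ⟨hz, by omega⟩
      · exact ⟨h.1.1, h.2⟩
  have hzE : z ∉ segment (contract V x y) m M := by simp [mem_segment, hmem]
  have hxE : x ∈ segment (contract V x y) m M := ⟨hxc, by omega⟩
  have hF : ∀ i ∈ segment (contract V x y) m M, inflate x y 2 f g i = 2 * f i := by
    intro i hi
    by_cases hix : i = x
    · subst hix
      rw [inflate_of_mem ⟨le_rfl, hxy⟩]
      simp [g, hxz.ne]
    · have := mem_contract.1 hi.1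
      exact inflate_of_notMem hg0 (by omega)
  have hFz : inflate x y 2 f g z = 2 * f x + if σ then 1 else -1 := by
    rw [inflate_of_mem ⟨hxz.le, hzy⟩, hgz]
  have hxyc := (hout x hx y hy hxz.ne hzy.ne' hxy).1 hCxy
  intro u hu w hw huw
  by_cases huz : u = z
  · subst huz
    rcases lt_trichotomy w y with hwy | rfl | hwy
    · have := honly w hw (by omega) hwy
      omega
    · have hno : ∀ t ∈ V, ¬ (u < t ∧ t < w) := fun t ht h => by
        have := honly t ht (by omega) h.2
        omega
      exact iff_of_true (hC.consecutive u hu w hw huw hno) (.segment_of_consecutive hno)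
    -- The chord `{z, w}` crosses `{x, y}`, so both the relation and convexity require `{x, w}` and
    -- `{y, w}`. Only if these are present does the orientation `σ` matter.
    · by_cases hP : C x w ∧ C y w
      · rw [hright w hw hwy hP.1 hP.2]
        have hwc := (hmem w).2 ⟨hw, huw.ne'⟩
        have hwM := (hV w hw).2
        have s1 : segment V u w = insert u (segment (contract V x y) y w) := by
          ext v
          simp only [Set.mem_insert_iff, mem_segment, hmem]
          constructor
          · intro h
            by_cases hvz : v = u
            · exact Or.inl hvz
            · refine Or.inr ⟨⟨h.1, hvz⟩, ?_, h.2.2⟩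
              by_contra hlt
              exact hvz (honly v h.1 (by omega) (by omega))
          · rintro (rfl | h)
            · exact ⟨hz, by omega⟩
            · exact ⟨h.1.1, by omega⟩
        have s2 : segment (contract V x y) x w = insert x (segment (contract V x y) y w) := by
          ext v
          simp only [Set.mem_insert_iff, mem_segment]
          constructor
          · intro h
            have := mem_contract.1 h.1
            by_cases hvx : v = x
            · exact Or.inl hvx
            · exact Or.inr ⟨h.1, by omega⟩
          · rintro (rfl | h)
            · exact ⟨hxc, by omega⟩
            · exact ⟨h.1, by omega⟩
        have hyw := (hf.convex_iff y hyc w hwc hwy).1 hP.2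
        have hxw := (hf.convex_iff x hxc w hwc (by omega)).1 hP.1
        rw [s2] at hxw
        have hsub := segment_mono (V := contract V x y) (hmx.trans hxy.le) hwM
        have hxn : x ∉ segment (contract V x y) y w := by simp [mem_segment, hxy]
        have hyin : y ∈ segment (contract V x y) y w := ⟨hyc, le_rfl, hwy⟩
        rw [s1, hE]
        refine (keyConvex_insert_iff hzE hxE hsub hxn ⟨y, hyin⟩ hF hFz hxw ?_).1.symm
        exact (hyw.forall_lt_or_forall_gt hf.injOn hsub hxE hxn).imp
          (fun h => ⟨h y hyin, h⟩) fun h => ⟨(h y hyin).not_gt, h⟩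
      · refine iff_of_false (fun h => hP ?_) fun h => hP ?_
        · exact (hC.crossing x hx u hu y hy w hw hxz hzy hwy hCxy h).2.2.symm
        · have := (KeyConvex.segment_of_crossing hinj hx hu hy hmx hxz hzy hwy
            (hV w hw).2 hxyc h).2.2.symm
          exact this.imp (hout x hx w hw hxz.ne huw.ne' (by omega)).2
            (hout y hy w hw hzy.ne' huw.ne' hwy).2
  by_cases hwz : w = z
  · subst hwz
    rcases lt_trichotomy u x with hux | rfl | hux
    · by_cases hP : C u x ∧ C u y
      · rw [hleft u hu hux hP.1 hP.2]
        have huc := (hmem u).2 ⟨hu, huz⟩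
        have hmu := (hV u hu).1
        have s1 : segment V u w = insert x (segment (contract V x y) u x) := by
          ext v
          simp only [Set.mem_insert_iff, mem_segment, hmem]
          constructor
          · intro h
            by_cases hvx : v = x
            · exact Or.inl hvx
            · refine Or.inr ⟨⟨h.1, by omega⟩, h.2.1, ?_⟩
              by_contra hlt
              have := honly v h.1 (by omega) (by omega)
              omega
          · rintro (rfl | h)
            · exact ⟨hx, by omega⟩
            · exact ⟨h.1.1, by omega⟩
        have s2 : segment (contract V x y) u y = insert x (segment (contract V x y) u x) := by
          ext v
          simp only [Set.mem_insert_iff, mem_segment]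
          constructor
          · intro h
            have := mem_contract.1 h.1
            by_cases hvx : v = x
            · exact Or.inl hvx
            · exact Or.inr ⟨h.1, by omega⟩
          · rintro (rfl | h)
            · exact ⟨hxc, by omega⟩
            · exact ⟨h.1, by omega⟩
        have hux' := (hf.convex_iff u huc x hxc hux).1 hP.1
        have huy := (hf.convex_iff u huc y hyc (by omega)).1 hP.2
        rw [s2] at huy
        have hsub := segment_mono (V := contract V x y) hmu (hxy.le.trans hyM)
        have hxn : x ∉ segment (contract V x y) u x := by simp [mem_segment]
        have huin : u ∈ segment (contract V x y) u x := ⟨huc, le_rfl, hux⟩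
        rw [s1, hE]
        refine (keyConvex_insert_iff hzE hxE hsub hxn ⟨u, huin⟩ hF hFz huy ?_).2.symm
        exact (hux'.forall_lt_or_forall_gt hf.injOn hsub hxE hxn).imp
          (fun h => ⟨h u huin, h⟩) fun h => ⟨(h u huin).not_gt, h⟩
      · refine iff_of_false (fun h => hP ?_) fun h => hP ?_
        · have := hC.crossing u hu x hx w hw y hy hux hxz hzy h hCxy
          exact ⟨this.1, this.2.2.2⟩
        · have := KeyConvex.segment_of_crossing hinj hu hx hw (hV u hu).1 hux hxz hzy hyM h hxyc
          exact ⟨(hout u hu x hx huz hxz.ne hux).2 this.1,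
            (hout u hu y hy huz hzy.ne' (by omega)).2 this.2.2.2⟩
    · have hno : ∀ t ∈ V, ¬ (u < t ∧ t < w) := fun t ht h => by
        have := honly t ht h.1 (by omega)
        omega
      exact iff_of_true (hC.consecutive u hu w hw huw hno) (.segment_of_consecutive hno)
    · have := honly u hu hux (by omega)
      omega
  · exact hout u hu w hw huz hwz huw

/-! ### The induction -/

/-- With only two inner vertices, `x`, `z₁`, `z₂`, `y` would form a quadrilateral, and a diagonal of
it would contradict minimality. -/
theorem IsFramedOn.four_le_card {C : ℕ → ℕ → Prop} {V : Finset ℕ} (hC : IsFramedOn C V) {x y : ℕ}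
    (hx : x ∈ V) (hy : y ∈ V) (hCxy : C x y)
    (hmin : ∀ u ∈ V, ∀ w ∈ V, x ≤ u → w ≤ y → (u, w) ≠ (x, y) → (∃ z ∈ V, u < z ∧ z < w) →
      ¬ C u w)
    (htwo : ∃ z₁ ∈ V, ∃ z₂ ∈ V, x < z₁ ∧ z₁ < z₂ ∧ z₂ < y) :
    4 ≤ (V.filter fun v => x ≤ v ∧ v < y).card := by
  obtain ⟨z₁, hz₁, z₂, hz₂, h1, h2, h3⟩ := htwo
  have hthree : ∃ t ∈ V, x < t ∧ t < y ∧ t ≠ z₁ ∧ t ≠ z₂ := by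
    by_contra! hn
    have hn' : ∀ t ∈ V, x < t → t < y → t = z₁ ∨ t = z₂ := fun t ht ha hb => by
      by_cases h : t = z₁
      · exact Or.inl h
      · exact Or.inr (hn t ht ha hb h)
    have c1 := hC.consecutive x hx z₁ hz₁ h1 fun t ht h => by
      have := hn' t ht (by omega) (by omega); omega
    have c2 := hC.consecutive z₁ hz₁ z₂ hz₂ h2 fun t ht h => by
      have := hn' t ht (by omega) (by omega); omega
    have c3 := hC.consecutive z₂ hz₂ y hy h3 fun t ht h => by
      have := hn' t ht (by omega) (by omega); omega
    rcases hC.quadrilateral x hx z₁ hz₁ z₂ hz₂ y hy h1 h2 h3 c1 c2 c3 hCxy with h | h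
    · exact hmin x hx z₂ hz₂ le_rfl h3.le (by simp; omega) ⟨z₁, hz₁, h1, h2⟩ h
    · exact hmin z₁ hz₁ y hy h1.le le_rfl (by simp; omega) ⟨z₂, hz₂, h2, h3⟩ h
  obtain ⟨t, ht, hxt, hty, ht1, ht2⟩ := hthree
  have hsub : ({x, z₁, z₂, t} : Finset ℕ) ⊆ V.filter fun v => x ≤ v ∧ v < y := by
    intro v hv
    simp only [Finset.mem_insert, Finset.mem_singleton] at hv
    rw [Finset.mem_filter]
    rcases hv with rfl | rfl | rfl | rfl
    · exact ⟨hx, by omega⟩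
    · exact ⟨hz₁, by omega⟩
    · exact ⟨hz₂, by omega⟩
    · exact ⟨ht, by omega⟩
  refine le_trans (le_of_eq ?_) (Finset.card_le_card hsub)
  rw [Finset.card_insert_of_notMem, Finset.card_insert_of_notMem, Finset.card_insert_of_notMem,
    Finset.card_singleton] <;> simp <;> omega

theorem IsFramedOn.exists_realizes {C : ℕ → ℕ → Prop} {m M : ℕ} (hmM : m < M) (hCmM : C m M) :
    ∀ (V : Finset ℕ), m ∈ V → M ∈ V → (∀ v ∈ V, m ≤ v ∧ v ≤ M) → IsFramedOn C V →
      ∃ f, Realizes C V m M f := by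
  intro V
  induction V using Finset.strongInduction with
  | H V ih =>
  intro hm hM hV hC
  by_cases hnt : ∃ p : ℕ × ℕ, p.1 ∈ V ∧ p.2 ∈ V ∧ C p.1 p.2 ∧ ∃ z ∈ V, p.1 < z ∧ z < p.2
  · obtain ⟨⟨x, y⟩, ⟨hx, hy, hCxy, z, hz, hxz, hzy⟩, hle⟩ :=
      exists_minimalFor_of_wellFoundedLT _ (fun p : ℕ × ℕ => p.2 - p.1) hnt
    dsimp only at hx hy hCxy hxz hzy hle
    have hxy : x < y := hxz.trans hzy
    have hmin : ∀ u ∈ V, ∀ w ∈ V, x ≤ u → w ≤ y → (u, w) ≠ (x, y) →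
        (∃ z ∈ V, u < z ∧ z < w) → ¬ C u w := by
      rintro u hu w hw hxu hwy hne ⟨t, ht, hut, htw⟩ hCuw
      have := @hle (u, w) ⟨hu, hw, hCuw, t, ht, hut, htw⟩ (by dsimp only; omega)
      dsimp only at this
      exact hne (by rw [Prod.mk.injEq]; omega)
    have hmx := (hV x hx).1
    have hyM := (hV y hy).2
    obtain ⟨f, hf⟩ := ih (contract V x y)
      (Finset.filter_ssubset.2 ⟨z, hz, not_not.2 ⟨hxz, hzy⟩⟩)
      (mem_contract.2 ⟨hm, by omega⟩) (mem_contract.2 ⟨hM, by omega⟩)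
      (fun v hv => hV v (mem_contract.1 hv).1) (hC.contract_of hxy hx hy hCxy)
    by_cases honly : ∀ t ∈ V, x < t → t < y → t = z
    · exact hf.exists_inflate_pair hV hC hx hz hy hxz hzy hCxy honly
    have htwo : ∃ z₁ ∈ V, ∃ z₂ ∈ V, x < z₁ ∧ z₁ < z₂ ∧ z₂ < y := by
      push Not at honly
      obtain ⟨t, ht, hxt, hty, htz⟩ := honly
      rcases lt_or_gt_of_ne htz with h | h
      · exact ⟨t, ht, z, hz, hxt, h, hzy⟩
      · exact ⟨z, hz, t, ht, hxz, h, hty⟩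
    obtain ⟨g, N, hginj, hg, hsimple⟩ :=
      exists_simple_key hx (hC.four_le_card hx hy hCxy hmin htwo)
    have hN : 0 < N := (abs_nonneg _).trans_lt (hg x ⟨hx, le_rfl, hxy⟩)
    have hg' : ∀ v, x ≤ v ∧ v < y → (if x ≤ v ∧ v < y then g v else 0) = g v :=
      fun v hv => if_pos hv
    -- The key of the block is cut off to `0` outside, as inflation requires.
    refine ⟨_, hf.inflate_simple (N := N) (g := fun v => if x ≤ v ∧ v < y then g v else 0) hV hC
      hx hy hxy hCxy hmin htwo ?_ (fun v hv => if_neg hv) ?_ ?_⟩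
    · intro v hv
      by_cases h : x ≤ v ∧ v < y
      · rw [hg' v h]
        exact hg v ⟨hv.1, h⟩
      · rw [if_neg h, abs_zero]
        exact hN
    · intro u hu v hv h
      dsimp only at h
      rw [hg' u hu.2, hg' v hv.2] at h
      exact hginj hu hv h
    · intro u hu w hw hxu hwy hne hz hconv
      refine hsimple u hu w hw hxu hwy hne hz fun i hi j hj k hk h1 h2 =>
        hconv i hi j hj k hk ?_ ?_ <;> dsimp only
      · rwa [hg' i ⟨hxu.trans hi.2.1, hi.2.2.trans_le hwy⟩, hg' k hk.2]
      · rwa [hg' j ⟨hxu.trans hj.2.1, hj.2.2.trans_le hwy⟩, hg' k hk.2]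
  · have hno : ∀ z ∈ V, ¬ (m < z ∧ z < M) := fun z hz h => hnt ⟨(m, M), hm, hM, hCmM, z, hz, h⟩
    have hall : ∀ v ∈ V, v = m ∨ v = M := fun v hv => by
      have := hV v hv
      have := hno v hv
      omega
    -- Only `m` and `M` remain, so the order has a single element.
    refine ⟨0, ?_, ?_⟩
    · intro u hu v hv _
      have := hall u hu.1
      have := hall v hv.1
      have := hu.2
      have := hv.2
      omega
    · intro u hu w hw huw
      have := hall u hu
      have := hall w hw
      obtain rfl : u = m := by omega
      obtain rfl : w = M := by omega
      exact iff_of_true hCmM (.segment_of_consecutive hno)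

/-! ### Permutations as keys -/

/-- The segments of `{0, …, n}` between two vertices. -/
abbrev seg (n u w : ℕ) : Set ℕ := segment (Finset.range (n + 1)) u w

theorem mem_seg {n u w v : ℕ} (hw : w ≤ n) : v ∈ seg n u w ↔ u ≤ v ∧ v < w := by
  simp only [mem_segment, Finset.mem_range]; omega

/-- Only the order that the key induces matters. Conversely, a convex set of values fills all
positions between its smallest and its largest one. -/
theorem isInterval_Icc_iff {n : ℕ} (π : Equiv.Perm (Fin n)) (f : ℕ → ℤ)
    (hf : ∀ i j : Fin n, π.symm i < π.symm j ↔ f i < f j) (a b : Fin n) (hab : a ≤ b) :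
    IsInterval π (Set.Icc a b) ↔ KeyConvex f (seg n 0 n) (seg n a (b + 1)) := by
  have hmem : ∀ v : Fin n, (v : ℕ) ∈ seg n a (b + 1) ↔ v ∈ Set.Icc a b := by
    intro v
    rw [mem_seg (by omega), Set.mem_Icc, Fin.le_def, Fin.le_def]
    omega
  have hlt : ∀ v ∈ seg n 0 n, v < n := fun v hv => hv.2.2
  have hlt' : ∀ v ∈ seg n a (b + 1), v < n := fun v hv => by have := hv.2; omega
  constructor
  · rintro ⟨-, i, j, -, hI⟩ p hp q hq k hk h1 h2
    obtain ⟨p, rfl⟩ : ∃ p' : Fin n, (p' : ℕ) = p := ⟨⟨p, hlt' p hp⟩, rfl⟩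
    obtain ⟨q, rfl⟩ : ∃ p' : Fin n, (p' : ℕ) = q := ⟨⟨q, hlt' q hq⟩, rfl⟩
    obtain ⟨k, rfl⟩ : ∃ p' : Fin n, (p' : ℕ) = k := ⟨⟨k, hlt k hk⟩, rfl⟩
    rw [hmem, hI] at hp hq ⊢
    rw [← hf] at h1 h2
    simp only [Equiv.image_eq_preimage_symm, Set.mem_preimage, Set.mem_Icc] at hp hq ⊢
    exact ⟨hp.1.trans h1.le, h2.le.trans hq.2⟩
  · intro h
    refine ⟨⟨a, b, hab, rfl⟩, ?_⟩
    have hne : (Finset.Icc a b).Nonempty := ⟨a, by simp [hab]⟩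
    obtain ⟨p, hp, hpmin⟩ := Finset.exists_min_image (Finset.Icc a b) π.symm hne
    obtain ⟨q, hq, hqmax⟩ := Finset.exists_max_image (Finset.Icc a b) π.symm hne
    refine ⟨π.symm p, π.symm q, hqmax p hp, ?_⟩
    ext v
    simp only [Equiv.image_eq_preimage_symm, Set.mem_preimage]
    rw [Finset.mem_Icc] at hp hq
    constructor
    · intro hv
      exact ⟨hpmin v (by simpa using hv), hqmax v (by simpa using hv)⟩
    · rintro ⟨h1, h2⟩
      rcases h1.lt_or_eq with h1 | h1
      · rcases h2.lt_or_eq with h2 | h2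
        · rw [← hmem]
          exact h p ((hmem p).2 hp) q ((hmem q).2 hq) v ((mem_seg le_rfl).2 (by omega))
            ((hf _ _).1 h1) ((hf _ _).1 h2)
        · exact π.symm.injective h2 ▸ hq
      · exact π.symm.injective h1 ▸ hp

/-- The positions of the values in a permutation. -/
def positionKey {n : ℕ} (π : Equiv.Perm (Fin n)) (i : ℕ) : ℤ :=
  if h : i < n then (π.symm ⟨i, h⟩ : ℕ) else 0

theorem positionKey_coe {n : ℕ} (π : Equiv.Perm (Fin n)) (i : Fin n) :
    positionKey π i = (π.symm i : ℕ) := by simp [positionKey]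

theorem positionKey_lt_iff {n : ℕ} (π : Equiv.Perm (Fin n)) (i j : Fin n) :
    π.symm i < π.symm j ↔ positionKey π i < positionKey π j := by
  rw [positionKey_coe, positionKey_coe, Fin.lt_def]; omega

theorem positionKey_injOn {n : ℕ} (π : Equiv.Perm (Fin n)) :
    Set.InjOn (positionKey π) (seg n 0 n) := by
  intro i hi j hj h
  obtain ⟨i, rfl⟩ : ∃ p : Fin n, (p : ℕ) = i := ⟨⟨i, hi.2.2⟩, rfl⟩
  obtain ⟨j, rfl⟩ : ∃ p : Fin n, (p : ℕ) = j := ⟨⟨j, hj.2.2⟩, rfl⟩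
  rw [positionKey_coe, positionKey_coe, Nat.cast_inj, Fin.val_inj] at h
  rw [π.symm.injective h]

/-- Every injective key is the key of a permutation. -/
theorem exists_perm_of_key {n : ℕ} (f : ℕ → ℤ) (hf : Set.InjOn f (seg n 0 n)) :
    ∃ π : Equiv.Perm (Fin n), ∀ i j : Fin n, π.symm i < π.symm j ↔ f i < f j := by
  have hinj : Function.Injective fun i : Fin n => f i := fun i j h =>
    Fin.ext (hf ((mem_seg le_rfl).2 (by omega)) ((mem_seg le_rfl).2 (by omega)) h)
  have hmono := (Tuple.monotone_sort fun i : Fin n => f i).strictMono_of_injective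
    (hinj.comp (Tuple.sort _).injective)
  refine ⟨Tuple.sort fun i : Fin n => f i, fun i j => ?_⟩
  rw [← hmono.lt_iff_lt]
  simp

/-! ### The image and the injectivity of `Phi` -/

theorem isOuterEdge_iff {n : ℕ} {x y : Fin (n + 1)} (hxy : x < y) :
    IsOuterEdge s(x, y) ↔ (y : ℕ) = x + 1 ∨ ((x : ℕ) = 0 ∧ (y : ℕ) = n) := by
  have hval : ∀ i : Fin (n + 1), ((i + 1 : Fin (n + 1)) : ℕ) =
      if (i : ℕ) = n then 0 else (i : ℕ) + 1 := by
    intro i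
    rw [Fin.val_add_one]
    simp [Fin.ext_iff]
  have hx := x.2
  have hy := y.2
  rw [Fin.lt_def] at hxy
  constructor
  · rintro ⟨i, h⟩
    rw [Sym2.eq_iff] at h
    have := hval i
    rcases h with ⟨rfl, rfl⟩ | ⟨rfl, rfl⟩ <;> split_ifs at this <;> omega
  · rintro (h | h)
    · refine ⟨x, ?_⟩
      have : y = x + 1 := by
        rw [Fin.ext_iff, hval, if_neg (by omega), h]
      rw [this]
    · refine ⟨y, ?_⟩
      have : x = y + 1 := by
        rw [Fin.ext_iff, hval, if_pos h.2, h.1]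
      rw [← this, Sym2.eq_swap]

theorem connected_comm {n : ℕ} {D : Set (Sym2 (Fin (n + 1)))} {x y : Fin (n + 1)} :
    Connected D x y ↔ Connected D y x := by
  rw [Connected, Connected, Sym2.eq_swap]

/-- The intervals that `Phi` omits, the singletons and the whole set, are the outer edges that
`Connected` adds back. -/
theorem connected_phi_iff {n : ℕ} (π : Equiv.Perm (Fin n)) (x y : Fin (n + 1))
    (hxy : x < y) : Connected (Phi (intervalPoset π)) x y ↔
      KeyConvex (positionKey π) (seg n 0 n) (seg n x y) := by
  have hlt := Fin.lt_def.1 hxy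
  have hyn := y.2
  obtain ⟨a, ha⟩ : ∃ a : Fin n, (a : ℕ) = x := ⟨⟨x, by omega⟩, rfl⟩
  obtain ⟨b, hb⟩ : ∃ b : Fin n, (b : ℕ) + 1 = y := ⟨⟨y - 1, by omega⟩, by simp; omega⟩
  have hab : a ≤ b := by rw [Fin.le_def]; omega
  have hI := isInterval_Icc_iff π _ (positionKey_lt_iff π) a b hab
  rw [ha, hb] at hI
  obtain rfl : x = a.castSucc := Fin.ext (by simp [ha])
  obtain rfl : y = b.succ := Fin.ext (by simp [hb])
  rw [← hI, Connected, isOuterEdge_iff hxy]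
  by_cases ho : IsOuterEdge s(a.castSucc, b.succ)
  · refine iff_of_true (Or.inr ((isOuterEdge_iff hxy).1 ho)) (hI.2 ?_)
    rcases (isOuterEdge_iff hxy).1 ho with h | ⟨h1, h2⟩
    · rw [h]
      exact .segment_of_consecutive fun z _ => by omega
    · rw [h1, h2]
      exact fun i _ j _ k hk _ _ => hk
  · rw [← isOuterEdge_iff hxy, or_iff_left ho]
    constructor
    · rintro ⟨-, a', b', hab', hmem, he⟩
      rw [Sym2.eq_iff] at he
      rcases he with ⟨h1, h2⟩ | ⟨h1, h2⟩
      · rw [Fin.castSucc_inj] at h1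
        rw [Fin.succ_inj] at h2
        rw [h1, h2]
        exact hmem
      · rw [Fin.ext_iff] at h1 h2
        rw [Fin.lt_def] at hab'
        simp only [Fin.val_castSucc, Fin.val_succ] at h1 h2 hlt
        omega
    · intro h
      refine ⟨⟨?_, ho⟩, a, b, ?_, h, rfl⟩
      · rw [Sym2.mk_isDiag_iff]; exact hxy.ne
      · rw [isOuterEdge_iff hxy] at ho
        rw [Fin.lt_def]
        simp only [Fin.val_castSucc, Fin.val_succ] at ho hlt
        omega

theorem phi_mem_framedDissections {n : ℕ} (π : Equiv.Perm (Fin n)) :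
    Phi (intervalPoset π) ∈ framedDissections n := by
  have hcon := connected_phi_iff π
  have hmemV : ∀ p : Fin (n + 1), (p : ℕ) ∈ Finset.range (n + 1) := fun p => Finset.mem_range.2 p.2
  refine ⟨fun e he => he.1, ?_, ?_⟩
  · have key : ∀ p q r s : Fin (n + 1), p < q → q < r → r < s →
        s(p, r) ∈ Phi (intervalPoset π) → s(q, s) ∈ Phi (intervalPoset π) →
        Connected (Phi (intervalPoset π)) p q ∧ Connected (Phi (intervalPoset π)) q r ∧
        Connected (Phi (intervalPoset π)) r s ∧ Connected (Phi (intervalPoset π)) p s := by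
      intro p q r s hpq hqr hrs h1 h2
      rw [hcon p q hpq, hcon q r hqr, hcon r s hrs, hcon p s (hpq.trans (hqr.trans hrs))]
      exact KeyConvex.segment_of_crossing (positionKey_injOn π) (hmemV p) (hmemV q) (hmemV r)
        (Nat.zero_le _) hpq hqr hrs (by omega) ((hcon p r (hpq.trans hqr)).1 (Or.inl h1))
        ((hcon q s (hqr.trans hrs)).1 (Or.inl h2))
    rintro a b c d h1 h2 ⟨p, q, r, s, hpq, hqr, hrs, h⟩
    have hk := key p q r s hpq hqr hrs
    rcases h with ⟨e1, e2⟩ | ⟨e1, e2⟩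
    · obtain ⟨k1, k2, k3, k4⟩ := hk (e1 ▸ h1) (e2 ▸ h2)
      have k1' := connected_comm.1 k1
      have k2' := connected_comm.1 k2
      have k3' := connected_comm.1 k3
      have k4' := connected_comm.1 k4
      rw [Sym2.eq_iff] at e1 e2
      rcases e1 with ⟨rfl, rfl⟩ | ⟨rfl, rfl⟩ <;> rcases e2 with ⟨rfl, rfl⟩ | ⟨rfl, rfl⟩ <;>
      exact ⟨by assumption, by assumption, by assumption, by assumption⟩
    · obtain ⟨k1, k2, k3, k4⟩ := hk (e2 ▸ h2) (e1 ▸ h1)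
      have k1' := connected_comm.1 k1
      have k2' := connected_comm.1 k2
      have k3' := connected_comm.1 k3
      have k4' := connected_comm.1 k4
      rw [Sym2.eq_iff] at e1 e2
      rcases e1 with ⟨rfl, rfl⟩ | ⟨rfl, rfl⟩ <;> rcases e2 with ⟨rfl, rfl⟩ | ⟨rfl, rfl⟩ <;>
      exact ⟨by assumption, by assumption, by assumption, by assumption⟩
  · rintro ⟨p, q, r, s, hpq, hqr, hrs, h1, h2, h3, h4, h5, h6⟩
    have hpr := hpq.trans hqr
    have hqs := hqr.trans hrs
    rw [hcon _ _ hpq] at h1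
    rw [hcon _ _ hqr] at h2
    rw [hcon _ _ hrs] at h3
    rw [hcon _ _ (hpr.trans hrs)] at h4
    -- Diagonals of a quadrilateral skip a vertex on both sides, so they are not outer edges and
    -- must belong to the dissection itself.
    have hin : ∀ u w : Fin (n + 1), u < w → ((w : ℕ) ≠ u + 1) → ¬ ((u : ℕ) = 0 ∧ (w : ℕ) = n) →
        KeyConvex (positionKey π) (seg n 0 n) (seg n u w) → s(u, w) ∈ Phi (intervalPoset π) := by
      intro u w huw e1 e2 h
      refine ((hcon u w huw).2 h).resolve_right fun ho => ?_
      rcases (isOuterEdge_iff huw).1 ho with h | h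
      · exact e1 h
      · exact e2 h
    have hs := s.2
    rw [Fin.lt_def] at hpq hqr hrs
    rcases KeyConvex.segment_of_quadrilateral (positionKey_injOn π) (Nat.zero_le _) hpq hqr hrs
      (by omega) h1 h2 h3 h4 with h | h
    · exact h5 (hin p r hpr (by omega) (by omega) h)
    · exact h6 (hin q s hqs (by omega) (by omega) h)

theorem phi_injOn {n : ℕ} : Set.InjOn Phi (intervalPosets n) := by
  have key : ∀ π π' : Equiv.Perm (Fin n), Phi (intervalPoset π) = Phi (intervalPoset π') →
      intervalPoset π ⊆ intervalPoset π' := by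
    intro π π' h I hI
    obtain ⟨a, b, hab, rfl⟩ := hI.1
    have hlt : a.castSucc < b.succ := Fin.castSucc_lt_succ_iff.2 hab
    have h1 := (isInterval_Icc_iff π _ (positionKey_lt_iff π) a b hab).1 hI
    have h2 := (connected_phi_iff π a.castSucc b.succ hlt).2 h1
    rw [h] at h2
    exact (isInterval_Icc_iff π' _ (positionKey_lt_iff π') a b hab).2
      ((connected_phi_iff π' a.castSucc b.succ hlt).1 h2)
  rintro _ ⟨π, rfl⟩ _ ⟨π', rfl⟩ h
  exact (key π π' h).antisymm (key π' π h.symm)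

/-! ### Surjectivity of `Phi` -/

/-- Connectedness in a dissection, as a relation on the numbers of the vertices. -/
def NatConnected {n : ℕ} (D : Set (Sym2 (Fin (n + 1)))) (x y : ℕ) : Prop :=
  ∃ p q : Fin (n + 1), (p : ℕ) = x ∧ (q : ℕ) = y ∧ Connected D p q

theorem natConnected_coe {n : ℕ} {D : Set (Sym2 (Fin (n + 1)))} {p q : Fin (n + 1)} :
    NatConnected D p q ↔ Connected D p q := by
  constructor
  · rintro ⟨p', q', hp, hq, h⟩
    rwa [Fin.ext hp, Fin.ext hq] at h
  · exact fun h => ⟨p, q, rfl, rfl, h⟩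

theorem isFramedOn_natConnected {n : ℕ} {D : Set (Sym2 (Fin (n + 1)))}
    (hD : D ∈ framedDissections n) : IsFramedOn (NatConnected D) (Finset.range (n + 1)) := by
  obtain ⟨-, hframed, hquad⟩ := hD
  have lift : ∀ p ∈ Finset.range (n + 1), ∃ p' : Fin (n + 1), (p' : ℕ) = p :=
    fun p hp => ⟨⟨p, Finset.mem_range.1 hp⟩, rfl⟩
  constructor
  · intro p hp q hq r hr s hs hpq hqr hrs h1 h2
    obtain ⟨p, rfl⟩ := lift p hp
    obtain ⟨q, rfl⟩ := lift q hq
    obtain ⟨r, rfl⟩ := lift r hr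
    obtain ⟨s, rfl⟩ := lift s hs
    rw [natConnected_coe] at h1 h2
    simp only [natConnected_coe]
    have hs' := s.2
    -- Outer edges cross nothing, so both chords are diagonals and framing applies.
    have h1' : s(p, r) ∈ D := h1.resolve_right fun h => by
      have := (isOuterEdge_iff (Fin.lt_def.2 (hpq.trans hqr))).1 h; omega
    have h2' : s(q, s) ∈ D := h2.resolve_right fun h => by
      have := (isOuterEdge_iff (Fin.lt_def.2 (hqr.trans hrs))).1 h; omega
    obtain ⟨k1, k2, k3, k4⟩ := hframed p r q s h1' h2'
      ⟨p, q, r, s, hpq, hqr, hrs, Or.inl ⟨rfl, rfl⟩⟩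
    exact ⟨connected_comm.1 k4, k3, k2, k1⟩
  · intro p hp q hq r hr s hs hpq hqr hrs h1 h2 h3 h4
    obtain ⟨p, rfl⟩ := lift p hp
    obtain ⟨q, rfl⟩ := lift q hq
    obtain ⟨r, rfl⟩ := lift r hr
    obtain ⟨s, rfl⟩ := lift s hs
    rw [natConnected_coe] at h1 h2 h3 h4
    rw [natConnected_coe, natConnected_coe]
    by_contra h
    rw [not_or] at h
    exact hquad ⟨p, q, r, s, hpq, hqr, hrs, h1, h2, h3, h4, fun h' => h.1 (Or.inl h'),
      fun h' => h.2 (Or.inl h')⟩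
  · intro p hp q hq hpq hno
    obtain ⟨p, rfl⟩ := lift p hp
    obtain ⟨q, rfl⟩ := lift q hq
    have := hno (p + 1) (Finset.mem_range.2 (by omega))
    exact natConnected_coe.2 (Or.inr ((isOuterEdge_iff (Fin.lt_def.2 hpq)).2 (by omega)))

theorem phi_surjOn {n : ℕ} (hn : 1 ≤ n) :
    Set.SurjOn Phi (intervalPosets n) (framedDissections n) := by
  intro D hD
  have htop : NatConnected D 0 n := by
    have hlt : (0 : Fin (n + 1)) < Fin.last n := by rw [Fin.lt_def]; simp; omega
    exact ⟨0, Fin.last n, rfl, rfl, Or.inr ((isOuterEdge_iff hlt).2 (Or.inr ⟨rfl, rfl⟩))⟩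
  obtain ⟨f, hf⟩ := IsFramedOn.exists_realizes (by omega) htop (Finset.range (n + 1))
    (by simp) (by simp) (fun v hv => by rw [Finset.mem_range] at hv; omega)
    (isFramedOn_natConnected hD)
  obtain ⟨π, hπ⟩ := exists_perm_of_key f hf.injOn
  have hmemV : ∀ p : Fin (n + 1), (p : ℕ) ∈ Finset.range (n + 1) := fun p => Finset.mem_range.2 p.2
  have hiff : ∀ a b : Fin n, a ≤ b →
      (Set.Icc a b ∈ intervalPoset π ↔ Connected D a.castSucc b.succ) := by
    intro a b hab
    have hlt : a.castSucc < b.succ := Fin.castSucc_lt_succ_iff.2 hab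
    rw [← natConnected_coe, hf.convex_iff _ (hmemV _) _ (hmemV _) hlt]
    exact isInterval_Icc_iff π f hπ a b hab
  refine ⟨intervalPoset π, ⟨π, rfl⟩, ?_⟩
  ext e
  constructor
  · rintro ⟨hdiag, a, b, hab, hmem, rfl⟩
    exact ((hiff a b hab.le).1 hmem).resolve_right hdiag.2
  · intro he
    have hdiag := hD.1 e he
    refine ⟨hdiag, ?_⟩
    have key : ∀ x y : Fin (n + 1), x < y → s(x, y) ∈ D → ∃ a b : Fin n, a < b ∧
        Set.Icc a b ∈ intervalPoset π ∧ s(x, y) = s(a.castSucc, b.succ) := by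
      intro x y hxy hin
      have ho := (hD.1 _ hin).2
      rw [isOuterEdge_iff hxy] at ho
      have hlt := Fin.lt_def.1 hxy
      obtain ⟨a, rfl⟩ : ∃ a : Fin n, a.castSucc = x := ⟨⟨x, by omega⟩, rfl⟩
      obtain ⟨b, rfl⟩ : ∃ b : Fin n, b.succ = y :=
        ⟨⟨y - 1, by omega⟩, Fin.ext (by simp; omega)⟩
      have hab : a < b := by
        rw [Fin.lt_def]
        simp only [Fin.val_castSucc, Fin.val_succ] at ho hlt
        omega
      exact ⟨a, b, hab, (hiff a b hab.le).2 (Or.inl hin), rfl⟩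
    induction e using Sym2.ind with
    | _ x y =>
      rcases lt_trichotomy x y with h | rfl | h
      · exact key x y h he
      · exact absurd (Sym2.mk_isDiag_iff.2 rfl) hdiag.1
      · rw [Sym2.eq_swap] at he ⊢
        exact key y x h he

theorem bijOn_phi {n : ℕ} (hn : 1 ≤ n) :
    Set.BijOn Phi (intervalPosets n) (framedDissections n) :=
  ⟨by rintro _ ⟨π, rfl⟩; exact phi_mem_framedDissections π, phi_injOn, phi_surjOn hn⟩

end IntervalPosets

/-- The map `Φ` is a bijection from the interval posets of permutations in `S_n` onto the
diagonally framed dissections of the convex `(n + 1)`-gon without quadrilaterals, so the two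
(finite) sets have the same number of elements. -/
theorem theorem1 (n : ℕ) (hn : 1 ≤ n) :
    (IntervalPosets.intervalPosets n).ncard = (IntervalPosets.framedDissections n).ncard ∧
      Set.BijOn IntervalPosets.Phi (IntervalPosets.intervalPosets n)
        (IntervalPosets.framedDissections n) := by
  have h := IntervalPosets.bijOn_phi hn
  exact ⟨by rw [← h.image_eq, h.injOn.ncard_image], h⟩
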